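/- Let $k$ be an algebraically closed field, $Q$ a finite quiver with arrow set $Q_1$, $Z$ a set of paths of $Q$ of length $\ge 2$ such that no proper subpath of a path in $Z$ lies in $Z$, and suppose that the monomial algebra $\Lambda=kQ/\langle Z\rangle$ is finite dimensional. Let $B$ be the set of paths of $Q$ containing no element of $Z$ as a subpath. Let ${\rm H}^1(\Lambda,\Lambda)$ be the Lie algebra of $k$-linear derivations of $\Lambda$ modulo inner derivations, and let $L_0$ be its degree-$0$ part, i.e. the Lie subalgebra of classes of those derivations that vanish on the vertices and send each arrow to a linear combination of arrows parallel to it (same source and same terminus). For parallel arrows $a,b$ write $(a,b)$ for the assignment $a\mapsto b$, $c\mapsto 0$ for all other arrows $c$ and for all vertices; a linear combination of such pairs is said to lie in $L_0$ if the corresponding assignment extends to a derivation of $\Lambda$, and it is then identified with the class of this derivation in $L_0$. For parallel arrows $a,b$ write $a\le b$ if, for every $p\in Z$, no path obtained from $p$ by replacing one appearance of $b$ by $a$ belongs to $B$; write $a\approx b$ if $a\le b$ and $b\le a$. This is an equivalence relation on each class $\overline\alpha$ of parallel arrows. Theorem. The following elements lie in $L_0$, and the solvable radical $\operatorname{Rad}L_0$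 is the $k$-linear span of them, where $\overline\alpha$ runs through all classes of parallel arrows: (1) $\sum_{\alpha\in S}(\alpha,\alpha)$ for every equivalence class $S\in\overline\alpha/{\approx}$; (2) $(a,b)$ for all $a\ne b$ in $\overline\alpha$ such that $(a,b)$ lies in $L_0$ and $(b,a)$ does not lie in $L_0$; (3) if $\operatorname{char}k=2$: $(a,b)$, $(b,a)$ and $(a,a)$ for every equivalence class $S=\{a,b\}\in\overline\alpha/{\approx}$ with exactly two arrows. Moreover, as a Lie algebra, $L_0/\operatorname{Rad}L_0$ is isomorphic to the product $\prod_S\mathfrak{pgl}(|S|,k)$, where $\mathfrak{pgl}(n,k)=\mathfrak{gl}(n,k)/k1$ and $S$ runs through all equivalence classes of $\approx$ on all classes of parallel arrows with $|S|\ge 2$, and with $|S|>2$ if $\operatorname{char}k=2$. -/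

import Mathlib

universe uk uq ua

attribute [local instance 100] LieRing.ofAssociativeRing

noncomputable section

namespace MonomialHH

open Quiver

/-! ### The path algebra of a finite quiver -/

section PathAlgebra

variable (k : Type uk) [Field k] (Q : Type uq) [Quiver.{ua} Q]

/-- The path algebra `kQ`: an element is a (finitely supported) family of coefficients on all
oriented paths, the paths being sorted by source and terminus. The quiver will always have
finitely many vertices. -/
def PathAlgebra : Type (max uk uq ua) := ∀ u v : Q, Path u v →₀ k

instance : AddCommGroup (PathAlgebra k Q) :=
  inferInstanceAs (AddCommGroup (∀ u v : Q, Path u v →₀ k))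

instance : Module k (PathAlgebra k Q) :=
  inferInstanceAs (Module k (∀ u v : Q, Path u v →₀ k))

variable {Q}

/-- Bilinear extension of concatenation: `concat k p q` is "first `p`, then `q`". -/
def concat (u v w : Q) : (Path u v →₀ k) →ₗ[k] (Path v w →₀ k) →ₗ[k] (Path u w →₀ k) :=
  Finsupp.linearCombination k fun p => Finsupp.lmapDomain k k fun q => p.comp q

@[simp]
theorem concat_single (u v w : Q) (p : Path u v) (q : Path v w) (a b : k) :
    concat k u v w (Finsupp.single p a) (Finsupp.single q b) =
      Finsupp.single (p.comp q) (a * b) := by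
  simp [concat, Finsupp.linearCombination_single, Finsupp.mapDomain_single]

theorem concat_assoc (u v w x : Q) (f : Path u v →₀ k) (g : Path v w →₀ k) (h : Path w x →₀ k) :
    concat k u w x (concat k u v w f g) h = concat k u v x f (concat k v w x g h) := by
  induction f using Finsupp.induction_linear with
  | zero => simp
  | add f f' hf hf' => simp [hf, hf']
  | single p a =>
    induction g using Finsupp.induction_linear with
    | zero => simp
    | add g g' hg hg' => simp [hg, hg']
    | single q b =>
      induction h using Finsupp.induction_linear with
      | zero => simp
      | add h h' hh hh' => rw [map_add, hh, hh', map_add, map_add]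
      | single r c => simp only [concat_single, Path.comp_assoc, mul_assoc]

theorem concat_nil_left (u w : Q) (g : Path u w →₀ k) :
    concat k u u w (Finsupp.single Path.nil 1) g = g := by
  induction g using Finsupp.induction_linear with
  | zero => simp
  | add g g' hg hg' => simp [hg, hg']
  | single q b => simp

theorem concat_nil_right (u w : Q) (g : Path u w →₀ k) :
    concat k u w w g (Finsupp.single Path.nil 1) = g := by
  induction g using Finsupp.induction_linear with
  | zero => simp
  | add g g' hg hg' => simp [hg, hg']
  | single q b => simp

variable {k}

theorem PathAlgebra.add_def (f g : PathAlgebra k Q) (u w : Q) :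
    (f + g) u w = f u w + g u w := rfl

theorem PathAlgebra.zero_def (u w : Q) : (0 : PathAlgebra k Q) u w = 0 := rfl

theorem PathAlgebra.smul_def (a : k) (f : PathAlgebra k Q) (u w : Q) :
    (a • f) u w = a • f u w := rfl

@[ext]
theorem PathAlgebra.ext {f g : PathAlgebra k Q} (h : ∀ u w, f u w = g u w) : f = g :=
  funext fun u => funext fun w => h u w

/-- The product `f * g` is "first `g`, then `f`": for paths `β`, `α` the product `β α` is the
concatenation if `α` ends where `β` starts, and `0` otherwise. -/
instance [Fintype Q] : Mul (PathAlgebra k Q) :=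
  ⟨fun f g u w => ∑ v, concat k u v w (g u v) (f v w)⟩

/-- The unit is the sum of the paths of length `0`. -/
instance [DecidableEq Q] : One (PathAlgebra k Q) :=
  ⟨fun u => Pi.single u (Finsupp.single Path.nil 1)⟩

theorem PathAlgebra.mul_def [Fintype Q] (f g : PathAlgebra k Q) (u w : Q) :
    (f * g) u w = ∑ v, concat k u v w (g u v) (f v w) := rfl

theorem PathAlgebra.one_def [DecidableEq Q] (u : Q) :
    (1 : PathAlgebra k Q) u = Pi.single u (Finsupp.single Path.nil 1) := rfl

variable [Fintype Q] [DecidableEq Q]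

instance : Ring (PathAlgebra k Q) where
  __ := (inferInstance : AddCommGroup (PathAlgebra k Q))
  left_distrib f g h := by
    ext1 u w
    simp [PathAlgebra.mul_def, PathAlgebra.add_def, Finset.sum_add_distrib]
  right_distrib f g h := by
    ext1 u w
    simp [PathAlgebra.mul_def, PathAlgebra.add_def, Finset.sum_add_distrib]
  zero_mul f := by
    ext1 u w
    simp [PathAlgebra.mul_def, PathAlgebra.zero_def]
  mul_zero f := by
    ext1 u w
    simp [PathAlgebra.mul_def, PathAlgebra.zero_def]
  mul_assoc f g h := by
    ext1 u w
    simp only [PathAlgebra.mul_def, map_sum, LinearMap.sum_apply]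
    rw [Finset.sum_comm]
    simp only [concat_assoc]
  one_mul f := by
    ext1 u w
    rw [PathAlgebra.mul_def, Finset.sum_eq_single w]
    · simp [PathAlgebra.one_def, concat_nil_right]
    · intro v _ hv
      simp [PathAlgebra.one_def, Pi.single_eq_of_ne hv.symm]
    · simp
  mul_one f := by
    ext1 u w
    rw [PathAlgebra.mul_def, Finset.sum_eq_single u]
    · simp [PathAlgebra.one_def, concat_nil_left]
    · intro v _ hv
      simp [PathAlgebra.one_def, Pi.single_eq_of_ne hv]
    · simp

instance : Algebra k (PathAlgebra k Q) :=
  Algebra.ofModule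
    (fun r f g => by
      ext1 u w
      simp [PathAlgebra.mul_def, PathAlgebra.smul_def, Finset.smul_sum])
    (fun r f g => by
      ext1 u w
      simp [PathAlgebra.mul_def, PathAlgebra.smul_def, Finset.smul_sum])

variable (k)

/-- A path, as an element of the path algebra. -/
def ofPath {u v : Q} (p : Path u v) : PathAlgebra k Q :=
  Pi.single u (Pi.single v (Finsupp.single p 1))

end PathAlgebra

/-! ### Monomial relations and monomial algebras -/

section Monomial

variable {Q : Type uq} [Quiver.{ua} Q]

/-- `z` is a subpath of `p`. -/
def IsSubpath {c d u v : Q} (z : Path c d) (p : Path u v) : Prop :=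
  ∃ (x : Path u c) (y : Path d v), p = (x.comp z).comp y

/-- `Z` is a set of paths of length at least `2` such that no proper subpath of a path in `Z` is
again in `Z`. -/
structure IsMinimalRelations (Z : ∀ u v : Q, Set (Path u v)) : Prop where
  two_le_length : ∀ (u v : Q) (p : Path u v), p ∈ Z u v → 2 ≤ p.length
  minimal : ∀ (u v : Q) (p : Path u v), p ∈ Z u v → ∀ (c d : Q) (z : Path c d), z ∈ Z c d →
    IsSubpath z p → ¬ z.length < p.length

/-- The set `B` of paths which do not contain an element of `Z` as a subpath. -/
def IsNonzeroPath (Z : ∀ u v : Q, Set (Path u v)) {u v : Q} (p : Path u v) : Prop :=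
  ∀ (c d : Q) (z : Path c d), z ∈ Z c d → ¬ IsSubpath z p

/-- For parallel arrows `a`, `b`, the ideal `⟨Z⟩` is `(a, b)`-saturated (written `a ≤ b`): for
every path `p` in `Z`, no replacement of one appearance of `b` in `p` by `a` gives a path in `B`,
that is, `p^(b,a) = 0`. -/
def IsSaturated (Z : ∀ u v : Q, Set (Path u v)) {u v : Q} (a b : u ⟶ v) : Prop :=
  ∀ (c d : Q) (l : Path c u) (r : Path v d), (l.cons b).comp r ∈ Z c d →
    ¬ IsNonzeroPath Z ((l.cons a).comp r)

/-- The relation `≈` on a class of parallel arrows. -/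
def ArrowEquiv (Z : ∀ u v : Q, Set (Path u v)) {u v : Q} (a b : u ⟶ v) : Prop :=
  IsSaturated Z a b ∧ IsSaturated Z b a

/-- `S` is an equivalence class of the relation `≈` on the class of arrows from `u` to `v`. -/
def IsArrowClass (Z : ∀ u v : Q, Set (Path u v)) {u v : Q} (S : Finset (u ⟶ v)) : Prop :=
  ∃ a : u ⟶ v, ∀ b : u ⟶ v, b ∈ S ↔ ArrowEquiv Z a b

variable (k : Type uk) [Field k] [Fintype Q] [DecidableEq Q]

/-- The monomial algebra `Λ = kQ / ⟨Z⟩`. -/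
def MonomialAlgebra (Z : ∀ u v : Q, Set (Path u v)) : Type (max uk uq ua) :=
  (TwoSidedIdeal.span
    {x : PathAlgebra k Q | ∃ (u v : Q), ∃ p ∈ Z u v, x = ofPath k p}).ringCon.Quotient

instance (Z : ∀ u v : Q, Set (Path u v)) : Ring (MonomialAlgebra k Z) :=
  inferInstanceAs (Ring (TwoSidedIdeal.span
    {x : PathAlgebra k Q | ∃ (u v : Q), ∃ p ∈ Z u v, x = ofPath k p}).ringCon.Quotient)

instance (Z : ∀ u v : Q, Set (Path u v)) : Algebra k (MonomialAlgebra k Z) :=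
  inferInstanceAs (Algebra k (TwoSidedIdeal.span
    {x : PathAlgebra k Q | ∃ (u v : Q), ∃ p ∈ Z u v, x = ofPath k p}).ringCon.Quotient)

/-- The canonical projection `kQ → Λ`. -/
def MonomialAlgebra.mk (Z : ∀ u v : Q, Set (Path u v)) : PathAlgebra k Q →ₐ[k] MonomialAlgebra k Z where
  __ := RingCon.mk' (TwoSidedIdeal.span
    {x : PathAlgebra k Q | ∃ (u v : Q), ∃ p ∈ Z u v, x = ofPath k p}).ringCon
  commutes' _ := rfl

/-- The class of a path in the monomial algebra. -/
def pathClass (Z : ∀ u v : Q, Set (Path u v)) {u v : Q} (p : Path u v) : MonomialAlgebra k Z :=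
  MonomialAlgebra.mk k Z (ofPath k p)

end Monomial

/-! ### The first Hochschild cohomology -/

section Hochschild

variable (k : Type uk) [Field k] (A : Type ua) [Ring A] [Algebra k A]

/-- The Lie algebra of `k`-linear derivations of `A`. -/
def derivations : LieSubalgebra k (Module.End k A) where
  carrier := {f | ∀ a b : A, f (a * b) = a * f b + f a * b}
  add_mem' {f g} hf hg a b := by
    simp only [LinearMap.add_apply, hf a b, hg a b, mul_add, add_mul]; abel
  zero_mem' a b := by simp
  smul_mem' c f hf a b := by
    simp only [LinearMap.smul_apply, hf a b, smul_add, mul_smul_comm, smul_mul_assoc]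
  lie_mem' {f g} hf hg a b := by
    have hf' : ∀ a b : A, f (a * b) = a * f b + f a * b := hf
    have hg' : ∀ a b : A, g (a * b) = a * g b + g a * b := hg
    simp only [Ring.lie_def, LinearMap.sub_apply, Module.End.mul_apply, hf', hg', map_add,
      mul_sub, sub_mul]
    abel

/-- The Lie ideal of inner derivations `x ↦ a x - x a`. -/
def innerDerivations : LieIdeal k (derivations k A) where
  carrier := {d | ∃ a : A, ∀ x : A, d.1 x = a * x - x * a}
  add_mem' := by
    rintro d d' ⟨a, ha⟩ ⟨b, hb⟩
    refine ⟨a + b, fun x => ?_⟩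
    change d.1 x + d'.1 x = _
    rw [ha, hb, add_mul, mul_add]; abel
  zero_mem' := ⟨0, fun x => by simp⟩
  smul_mem' := by
    rintro c d ⟨a, ha⟩
    refine ⟨c • a, fun x => ?_⟩
    change c • d.1 x = _
    rw [ha, smul_sub, smul_mul_assoc, mul_smul_comm]
  lie_mem := by
    rintro f d ⟨a, ha⟩
    have hf : ∀ a b : A, f.1 (a * b) = a * f.1 b + f.1 a * b := f.2
    refine ⟨f.1 a, fun x => ?_⟩
    simp only [LieSubalgebra.coe_bracket, Ring.lie_def, LinearMap.sub_apply,
      Module.End.mul_apply, ha, map_sub, hf]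
    abel

/-- The first Hochschild cohomology `H¹(A, A)`: derivations modulo inner derivations. -/
def HH1 : Type ua := derivations k A ⧸ innerDerivations k A

instance : LieRing (HH1 k A) :=
  inferInstanceAs (LieRing (derivations k A ⧸ innerDerivations k A))

instance : LieAlgebra k (HH1 k A) :=
  inferInstanceAs (LieAlgebra k (derivations k A ⧸ innerDerivations k A))

/-- The class of a derivation, as a Lie algebra morphism. -/
def HH1.mk : derivations k A →ₗ⁅k⁆ HH1 k A where
  __ := (innerDerivations k A).toSubmodule.mkQ
  map_lie' {x y} := LieSubmodule.Quotient.mk_bracket (innerDerivations k A) x y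

end Hochschild

/-! ### The degree zero part of `H¹(Λ, Λ)` -/

section DegreeZero

variable (k : Type uk) [Field k] {Q : Type uq} [Quiver.{ua} Q] [Fintype Q] [DecidableEq Q]
  (Z : ∀ u v : Q, Set (Path u v))

/-- The span in `Λ` of the arrows from `u` to `v`. -/
def arrowSpan (u v : Q) : Submodule k (MonomialAlgebra k Z) :=
  Submodule.span k (Set.range fun b : u ⟶ v => pathClass k Z b.toPath)

/-- The derivations of `Λ` of degree zero: they vanish on the vertices and send every arrow to a
linear combination of arrows parallel to it. -/
def degreeZeroDerivations : LieSubalgebra k (derivations k (MonomialAlgebra k Z)) where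
  carrier := {d | (∀ e : Q, d.1 (pathClass k Z (Path.nil : Path e e)) = 0) ∧
    ∀ (u v : Q) (a : u ⟶ v), d.1 (pathClass k Z a.toPath) ∈ arrowSpan k Z u v}
  add_mem' := by
    rintro d d' ⟨h, h'⟩ ⟨g, g'⟩
    exact ⟨fun e => by simp [h, g], fun u v a => Submodule.add_mem _ (h' u v a) (g' u v a)⟩
  zero_mem' := ⟨fun e => rfl, fun u v a => Submodule.zero_mem _⟩
  smul_mem' := by
    rintro c d ⟨h, h'⟩
    exact ⟨fun e => by simp [h], fun u v a => Submodule.smul_mem _ c (h' u v a)⟩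
  lie_mem' := by
    have key : ∀ d : derivations k (MonomialAlgebra k Z), ∀ u v : Q,
        (∀ a : u ⟶ v, d.1 (pathClass k Z a.toPath) ∈ arrowSpan k Z u v) →
        arrowSpan k Z u v ≤ (arrowSpan k Z u v).comap d.1 := by
      intro d u v h
      refine Submodule.span_le.2 ?_
      rintro _ ⟨b, rfl⟩
      exact h b
    rintro d d' ⟨h, h'⟩ ⟨g, g'⟩
    refine ⟨fun e => ?_, fun u v a => ?_⟩
    · simp [LieSubalgebra.coe_bracket, Ring.lie_def, h, g]
    · simp only [LieSubalgebra.coe_bracket, Ring.lie_def, LinearMap.sub_apply,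
        Module.End.mul_apply]
      exact Submodule.sub_mem _ (key d u v (h' u v) (g' u v a)) (key d' u v (g' u v) (h' u v a))

/-- The degree zero part `L₀` of `H¹(Λ, Λ)`, a Lie subalgebra: the classes of the derivations of
degree zero. -/
def L0 : LieSubalgebra k (HH1 k (MonomialAlgebra k Z)) :=
  (degreeZeroDerivations k Z).map (HH1.mk k (MonomialAlgebra k Z))

variable (Q) in
/-- The set `Q₁//Q₁` of pairs of parallel arrows. -/
abbrev ParallelArrows : Type (max uq ua) := Σ (u v : Q), (u ⟶ v) × (u ⟶ v)

/-- The pair `(a, b)` of parallel arrows, as an element of `k(Q₁//Q₁)`. -/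
def pair {u v : Q} (a b : u ⟶ v) : ParallelArrows Q →₀ k :=
  Finsupp.single ⟨u, v, a, b⟩ 1

variable [∀ u v : Q, Fintype (u ⟶ v)]
variable {k}

/-- The derivation `d` of `Λ` corresponds to the element `x = ∑ x_(a,b) (a, b)` of `k(Q₁//Q₁)`:
it vanishes on vertices and sends each arrow `a` to `∑_b x_(a,b) b`. -/
def IsGivenBy (d : derivations k (MonomialAlgebra k Z)) (x : ParallelArrows Q →₀ k) : Prop :=
  (∀ e : Q, d.1 (pathClass k Z (Path.nil : Path e e)) = 0) ∧
    ∀ (u v : Q) (a : u ⟶ v),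
      d.1 (pathClass k Z a.toPath) = ∑ b : u ⟶ v, x ⟨u, v, a, b⟩ • pathClass k Z b.toPath

/-- `x ∈ k(Q₁//Q₁)` is a cocycle, that is, it is given by a derivation of `Λ`, so that it defines
an element of `L₀`. -/
def IsCocycle (x : ParallelArrows Q →₀ k) : Prop :=
  ∃ d : derivations k (MonomialAlgebra k Z), IsGivenBy Z d x

variable (k)

/-- The sums `∑_{α ∈ S} (α, α)` over the classes `S` of `≈`. -/
def classSums : Set (ParallelArrows Q →₀ k) :=
  {x | ∃ (u v : Q) (S : Finset (u ⟶ v)), IsArrowClass Z S ∧ x = ∑ a ∈ S, pair k a a}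

/-- The pairs `(a, b)`, `a ≠ b`, in `L₀` for which `(b, a)` is not in `L₀`. -/
def strictPairs : Set (ParallelArrows Q →₀ k) :=
  {x | ∃ (u v : Q) (a b : u ⟶ v), a ≠ b ∧ IsCocycle Z (pair k a b) ∧
    ¬ IsCocycle Z (pair k b a) ∧ x = pair k a b}

/-- In characteristic two, the elements `(a, b)`, `(b, a)`, `(a, a)` for the classes
`S = {a, b}` of `≈` with exactly two arrows. -/
def charTwoElements : Set (ParallelArrows Q →₀ k) :=
  {x | CharP k 2 ∧ ∃ (u v : Q) (S : Finset (u ⟶ v)), IsArrowClass Z S ∧ S.card = 2 ∧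
    ∃ a ∈ S, ∃ b ∈ S, a ≠ b ∧ (x = pair k a b ∨ x = pair k b a ∨ x = pair k a a)}

/-- The three kinds of elements taken together. -/
def radicalGenerators : Set (ParallelArrows Q →₀ k) :=
  classSums k Z ∪ strictPairs k Z ∪ charTwoElements k Z

/-- The elements of `L₀` defined by a set of elements of `k(Q₁//Q₁)`. -/
def classesInL0 (X : Set (ParallelArrows Q →₀ k)) : Set (L0 k Z) :=
  {y | ∃ x ∈ X, ∃ d : derivations k (MonomialAlgebra k Z), IsGivenBy Z d x ∧
    (y : HH1 k (MonomialAlgebra k Z)) = HH1.mk k (MonomialAlgebra k Z) d}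

/-- The classes `S` of `≈` (over all classes of parallel arrows) with at least two arrows, and
with more than two arrows in characteristic two. -/
abbrev PglFactor : Type (max uq ua) :=
  {S : Σ (u v : Q), Finset (u ⟶ v) // IsArrowClass Z S.2.2 ∧ 2 ≤ S.2.2.card ∧
    (CharP k 2 → 2 < S.2.2.card)}

end DegreeZero

/-! ### The Lie algebras `pgl(n, k)` and their products -/

section Pgl

variable (n : ℕ) (k : Type uk) [Field k]

/-- The Lie ideal `k1` of scalar matrices in `gl(n, k)`. -/
def scalarMatrices : LieIdeal k (Matrix (Fin n) (Fin n) k) where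
  __ := Submodule.span k {(1 : Matrix (Fin n) (Fin n) k)}
  lie_mem {x m} hm := by
    obtain ⟨c, rfl⟩ := Submodule.mem_span_singleton.1 hm
    have : ⁅x, c • (1 : Matrix (Fin n) (Fin n) k)⁆ = 0 := by
      simp [Ring.lie_def]
    rw [this]
    exact Submodule.zero_mem _

/-- `pgl(n, k) = gl(n, k) / k1`. -/
def Pgl : Type uk := Matrix (Fin n) (Fin n) k ⧸ scalarMatrices n k

instance : LieRing (Pgl n k) :=
  inferInstanceAs (LieRing (Matrix (Fin n) (Fin n) k ⧸ scalarMatrices n k))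

instance : LieAlgebra k (Pgl n k) :=
  inferInstanceAs (LieAlgebra k (Matrix (Fin n) (Fin n) k ⧸ scalarMatrices n k))

variable {ι : Type*} (L : ι → Type*) [∀ i, LieRing (L i)] [∀ i, LieAlgebra k (L i)]

/-- The product of a family of Lie algebras, with the componentwise bracket. -/
def LieProduct : Type _ := ∀ i, L i

instance : AddCommGroup (LieProduct L) := inferInstanceAs (AddCommGroup (∀ i, L i))

instance : Module k (LieProduct L) := inferInstanceAs (Module k (∀ i, L i))

instance : LieRing (LieProduct L) where
  bracket x y i := ⁅x i, y i⁆
  add_lie x y z := funext fun i => add_lie (x i) (y i) (z i)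
  lie_add x y z := funext fun i => lie_add (x i) (y i) (z i)
  lie_self x := funext fun i => lie_self (x i)
  leibniz_lie x y z := funext fun i => leibniz_lie (x i) (y i) (z i)

instance : LieAlgebra k (LieProduct L) where
  lie_smul c x y := funext fun i => lie_smul c (x i) (y i)

end Pgl

end MonomialHH

end

noncomputable section

namespace MonomialHH

open Quiver

/-! ### Coefficients on nonzero paths -/

section Paths

variable {k : Type uk} [Field k] {Q : Type uq} [Quiver.{ua} Q]

/-! A derivation of degree zero is determined by one square matrix for each pair of vertices, whose
entry (b, a) is the coefficient of the arrow b in the image of the arrow a. On kQ every family of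
matrices gives a derivation, which replaces one arrow of a path at a time. It descends to Λ exactly
when b ≤ a for each nonzero entry (b, a): the image of p ∈ Z must vanish in Λ, and a path obtained
by replacing one chosen a of p by b ≠ a occurs in that image with coefficient exactly the entry (b,
a), so nothing can cancel. Hence degree zero derivations are the families of matrices supported on
the preorder ≤ (`isSaturated_of_coeffMatrix_ne_zero`, `exists_coeffMatrix_eq`).

If a ≤ t ≤ b and a ≈ b, then t lies in the same class, so passing to the diagonal block on a class
is multiplicative. Taking these blocks modulo scalars on the large classes (at least two arrows,
more than two in characteristic 2) gives a surjective Lie morphism `blocks` onto the product of the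
pgl(|S|, k). An inner derivation of degree zero is a scalar on the arrows from u to v, so `blocks`
factors through L₀.

The kernel of `blocks` is solvable: its blocks are scalar on large classes and of size 1 otherwise,
except for gl(2, k) in characteristic 2, which is solvable; what remains is strictly triangular
(`isSolvable_ker_blocks`). The target has no nonzero solvable ideal, since a nonzero ideal of a
factor contains the classes of all off-diagonal matrix units, and these are brackets of each other
(`Pgl.eq_bot_of_isSolvable`). Therefore the radical of L₀ is the image of the kernel, and the
quotient is the product (`radical_of_factorization`).

The generators come from reading the kernel entry by entry: off-diagonal entries between
inequivalent arrows give (2), constant diagonals on a class give (1), and the two-arrow classes in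
characteristic 2 give (3) (`ker_blocks_eq_span`). -/

theorem exists_comp_of_concat_apply_ne_zero {u v w : Q} (f : Path u v →₀ k) (g : Path v w →₀ k)
    {s : Path u w} (h : concat k u v w f g s ≠ 0) :
    ∃ p q, f p ≠ 0 ∧ g q ≠ 0 ∧ p.comp q = s := by
  classical
  have h1 : concat k u v w f g s =
      ∑ p ∈ f.support, f p * (Finsupp.mapDomain (fun q => p.comp q) g) s := by
    simp [concat, Finsupp.linearCombination_apply, Finsupp.sum, LinearMap.sum_apply,
      Finsupp.finsetSum_apply]
  rw [h1] at h
  obtain ⟨p, hp, hne⟩ := Finset.exists_ne_zero_of_sum_ne_zero h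
  have h2 : s ∈ (Finsupp.mapDomain (fun q => p.comp q) g).support :=
    Finsupp.mem_support_iff.2 (right_ne_zero_of_mul hne)
  obtain ⟨q, hq, rfl⟩ := Finset.mem_image.1 (Finsupp.mapDomain_support h2)
  exact ⟨p, q, Finsupp.mem_support_iff.1 hp, Finsupp.mem_support_iff.1 hq, rfl⟩

theorem concat_single_left_apply {u v w : Q} (p : Path u v) (g : Path v w →₀ k) (q : Path v w) :
    concat k u v w (Finsupp.single p 1) g (p.comp q) = g q := by
  have : concat k u v w (Finsupp.single p 1) g = Finsupp.mapDomain (fun q => p.comp q) g := by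
    simp [concat, Finsupp.linearCombination_single]
  rw [this]
  exact Finsupp.mapDomain_apply (p.comp_injective_right) g q

theorem concat_single_right_apply {u v w : Q} (f : Path u v →₀ k) (q : Path v w) (p : Path u v) :
    concat k u v w f (Finsupp.single q 1) (p.comp q) = f p := by
  induction f using Finsupp.induction_linear with
  | zero => simp
  | add f g hf hg => simp [hf, hg]
  | single r a =>
    classical
    simp only [concat_single, mul_one, Finsupp.single_apply, Path.comp_inj_left]

variable {Z : ∀ u v : Q, Set (Path u v)}

theorem IsNonzeroPath.left {u v w : Q} {p : Path u v} {q : Path v w}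
    (h : IsNonzeroPath Z (p.comp q)) : IsNonzeroPath Z p := by
  rintro c d z hz ⟨x, y, rfl⟩
  exact h c d z hz ⟨x, y.comp q, by simp [Path.comp_assoc]⟩

theorem IsNonzeroPath.right {u v w : Q} {p : Path u v} {q : Path v w}
    (h : IsNonzeroPath Z (p.comp q)) : IsNonzeroPath Z q := by
  rintro c d z hz ⟨x, y, rfl⟩
  exact h c d z hz ⟨p.comp x, y, by simp [Path.comp_assoc]⟩

theorem IsMinimalRelations.isNonzeroPath_toPath (hZ : IsMinimalRelations Z) {u v : Q}
    (a : u ⟶ v) : IsNonzeroPath Z a.toPath := by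
  rintro c d z hz ⟨x, y, h⟩
  have h1 := hZ.two_le_length c d z hz
  have h2 := congrArg Path.length h
  simp only [Path.length_toPath, Path.length_comp] at h2
  omega

theorem toPath_eq_comp_iff {u v : Q} (a b : u ⟶ v) (q : Path v v) :
    a.toPath.comp q = b.toPath ↔ a = b ∧ q = Path.nil := by
  constructor
  · intro h
    have h2 := congrArg Path.length h
    simp only [Path.length_toPath, Path.length_comp] at h2
    obtain rfl := Path.eq_nil_of_length_zero q (by omega)
    refine ⟨?_, rfl⟩
    rw [Path.comp_nil] at h
    exact eq_of_heq (Path.hom_heq_of_cons_eq_cons h)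
  · rintro ⟨rfl, rfl⟩; rfl

theorem toPath_injective {u v : Q} {a b : u ⟶ v} (h : a.toPath = b.toPath) : a = b :=
  eq_of_heq (Path.hom_heq_of_cons_eq_cons h)

end Paths

/-! ### Coefficients and linear maps on the monomial algebra -/

section Quotient

variable (k : Type uk) [Field k] {Q : Type uq} [Quiver.{ua} Q] [Fintype Q] [DecidableEq Q]
  (Z : ∀ u v : Q, Set (Path u v))

/-- The inclusion of the span of the paths from `u` to `v` in the path algebra. -/
def embed (u v : Q) : (Path u v →₀ k) →ₗ[k] PathAlgebra k Q where
  toFun f := Pi.single u (Pi.single v f)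
  map_add' f g := by rw [Pi.single_add, Pi.single_add]; rfl
  map_smul' c f := by rw [Pi.single_smul, Pi.single_smul]; rfl

variable {k}

theorem embed_apply_self {u v : Q} (f : Path u v →₀ k) : embed k u v f u v = f := by
  change (Pi.single u (Pi.single v f) : ∀ u v : Q, Path u v →₀ k) u v = f
  simp

theorem ofPath_eq_embed {u v : Q} (p : Path u v) :
    ofPath k p = embed k u v (Finsupp.single p 1) := rfl

theorem embed_apply {u v : Q} (f : Path u v →₀ k) (x y : Q) :
    embed k u v f x y = (Pi.single u (Pi.single v f) : ∀ u v : Q, Path u v →₀ k) x y := rfl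

theorem mul_embed {u v w : Q} (g : PathAlgebra k Q) (f : Path u v →₀ k) :
    (g * embed k u v f) u w = concat k u v w f (g v w) := by
  rw [PathAlgebra.mul_def, Finset.sum_eq_single v]
  · rw [embed_apply_self]
  · intro x _ hx
    rw [embed_apply]
    simp [hx]
  · simp

theorem embed_mul {u v w : Q} (f : PathAlgebra k Q) (g : Path v w →₀ k) :
    (embed k v w g * f) u w = concat k u v w (f u v) g := by
  rw [PathAlgebra.mul_def, Finset.sum_eq_single v]
  · rw [embed_apply_self]
  · intro x _ hx
    rw [embed_apply]
    simp [hx]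
  · simp

theorem embed_mul_embed {u v w : Q} (f : Path u v →₀ k) (g : Path v w →₀ k) :
    embed k v w g * embed k u v f = embed k u w (concat k u v w f g) := by
  ext1 x y
  rw [PathAlgebra.mul_def]
  by_cases hx : x = u
  · subst hx
    by_cases hy : y = w
    · subst hy
      rw [← PathAlgebra.mul_def, mul_embed, embed_apply_self, embed_apply_self]
    · rw [← PathAlgebra.mul_def, mul_embed]
      simp [embed_apply, hy]
  · rw [embed_apply]
    simp [embed_apply, hx]

theorem eq_sum_embed (f : PathAlgebra k Q) : f = ∑ u, ∑ v, embed k u v (f u v) := by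
  ext1 x y
  have h : ∀ s : Q → PathAlgebra k Q, (∑ u, s u) x y = ∑ u, s u x y := by
    intro s
    exact (congrFun (Finset.sum_apply x Finset.univ (fun u => (s u : ∀ u v : Q, Path u v →₀ k))) y).trans
      (Finset.sum_apply y Finset.univ _)
  simp only [h]
  rw [Finset.sum_eq_single x, Finset.sum_eq_single y, embed_apply_self]
  · intro v _ hv
    simp [embed_apply, hv.symm]
  · simp
  · intro u _ hu
    simp [embed_apply, hu.symm]
  · simp

theorem linearMap_ext_ofPath {N : Type*} [AddCommGroup N] [Module k N]
    {f g : PathAlgebra k Q →ₗ[k] N} (h : ∀ (u v : Q) (p : Path u v), f (ofPath k p) = g (ofPath k p)) :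
    f = g := by
  refine LinearMap.ext fun x => ?_
  rw [eq_sum_embed x, map_sum, map_sum]
  refine Finset.sum_congr rfl fun u _ => ?_
  rw [map_sum, map_sum]
  refine Finset.sum_congr rfl fun v _ => ?_
  have : f ∘ₗ embed k u v = g ∘ₗ embed k u v := by
    refine Finsupp.lhom_ext' fun p => LinearMap.ext_ring ?_
    exact h u v p
  exact LinearMap.congr_fun this _

variable (k) in
theorem mk_surjective : Function.Surjective (MonomialAlgebra.mk k Z) := Quotient.mk_surjective

/-- The two-sided ideal generated by `Z` in the path algebra. -/
abbrev relationIdeal (k : Type uk) [Field k] : TwoSidedIdeal (PathAlgebra k Q) :=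
  TwoSidedIdeal.span {x : PathAlgebra k Q | ∃ (u v : Q), ∃ p ∈ Z u v, x = ofPath k p}

theorem mk_eq_zero_iff (f : PathAlgebra k Q) :
    MonomialAlgebra.mk k Z f = 0 ↔ f ∈ relationIdeal Z k := by
  rw [TwoSidedIdeal.mem_iff]
  exact RingCon.eq _

variable {Z}

/-- Both factors of a path in B lie in B, so the elements without any term in B form a two-sided
ideal; it contains Z, hence ⟨Z⟩. This makes the coefficient of a path in B well defined on Λ. -/
theorem apply_eq_zero_of_mk_eq_zero {f : PathAlgebra k Q} (hf : MonomialAlgebra.mk k Z f = 0)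
    {u v : Q} {p : Path u v} (hp : IsNonzeroPath Z p) : f u v p = 0 := by
  let J : TwoSidedIdeal (PathAlgebra k Q) := TwoSidedIdeal.mk'
    {f | ∀ (u v : Q) (p : Path u v), IsNonzeroPath Z p → f u v p = 0}
    (fun u v p _ => rfl)
    (fun {f g} hf hg u v p hp => by
      rw [PathAlgebra.add_def, Finsupp.add_apply, hf u v p hp, hg u v p hp, add_zero])
    (fun {f} hf u v p hp => by
      change -(f u v p) = 0
      rw [hf u v p hp, neg_zero])
    (fun {f g} hg u w p hp => by
      rw [PathAlgebra.mul_def, Finsupp.finsetSum_apply]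
      refine Finset.sum_eq_zero fun v _ => ?_
      by_contra h
      obtain ⟨q, r, hq, hr, rfl⟩ := exists_comp_of_concat_apply_ne_zero _ _ h
      exact hq (hg _ _ q hp.left))
    (fun {f g} hf u w p hp => by
      rw [PathAlgebra.mul_def, Finsupp.finsetSum_apply]
      refine Finset.sum_eq_zero fun v _ => ?_
      by_contra h
      obtain ⟨q, r, hq, hr, rfl⟩ := exists_comp_of_concat_apply_ne_zero _ _ h
      exact hr (hf _ _ r hp.right))
  have hJ : relationIdeal Z k ≤ J := by
    refine TwoSidedIdeal.span_le.2 ?_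
    rintro _ ⟨c, d, z, hz, rfl⟩
    refine (TwoSidedIdeal.mem_mk' _ _ _ _ _ _ _).2 fun u v p hp => ?_
    by_contra h
    rw [ofPath_eq_embed, embed_apply] at h
    by_cases hu : u = c
    · subst hu
      by_cases hv : v = d
      · subst hv
        have hzp : z = p := by
          classical
          by_contra hne
          simp [hne] at h
        subst hzp
        exact hp _ _ z hz ⟨Path.nil, Path.nil, by simp⟩
      · simp [hv] at h
    · simp [hu] at h
  exact (TwoSidedIdeal.mem_mk' _ _ _ _ _ _ _).1 (hJ ((mk_eq_zero_iff Z f).1 hf)) u v p hp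

theorem pathClass_comp {u v w : Q} (p : Path u v) (q : Path v w) :
    pathClass k Z (p.comp q) = pathClass k Z q * pathClass k Z p := by
  rw [pathClass, pathClass, pathClass, ← map_mul, ofPath_eq_embed, ofPath_eq_embed,
    ofPath_eq_embed, embed_mul_embed, concat_single, mul_one]

theorem pathClass_eq_zero {u v : Q} {p : Path u v} (hp : ¬ IsNonzeroPath Z p) :
    pathClass k Z p = 0 := by
  rw [IsNonzeroPath] at hp
  push Not at hp
  obtain ⟨c, d, z, hz, x, y, rfl⟩ := hp
  have : pathClass k Z z = 0 :=
    (mk_eq_zero_iff Z _).2 (TwoSidedIdeal.subset_span ⟨c, d, z, hz, rfl⟩)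
  rw [pathClass_comp, pathClass_comp, this, zero_mul, mul_zero]

theorem monomialAlgebra_linearMap_ext {N : Type*} [AddCommGroup N] [Module k N]
    {f g : MonomialAlgebra k Z →ₗ[k] N}
    (h : ∀ (u v : Q) (p : Path u v), f (pathClass k Z p) = g (pathClass k Z p)) : f = g := by
  have := linearMap_ext_ofPath (f := f ∘ₗ (MonomialAlgebra.mk k Z).toLinearMap)
    (g := g ∘ₗ (MonomialAlgebra.mk k Z).toLinearMap) h
  refine LinearMap.ext fun x => ?_
  obtain ⟨x, rfl⟩ := mk_surjective k Z x
  exact LinearMap.congr_fun this x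

/-- Descent of a linear map along the projection `kQ → Λ`. -/
def descend {N : Type*} [AddCommGroup N] [Module k N] (T : PathAlgebra k Q →ₗ[k] N)
    (hT : ∀ f, MonomialAlgebra.mk k Z f = 0 → T f = 0) : MonomialAlgebra k Z →ₗ[k] N :=
  have key : ∀ f g, MonomialAlgebra.mk k Z f = MonomialAlgebra.mk k Z g → T f = T g := by
    intro f g h
    rw [← sub_eq_zero, ← map_sub]
    exact hT _ (by rw [map_sub, h, sub_self])
  { toFun := fun x => T (Function.surjInv (mk_surjective k Z) x)
    map_add' := fun x y => by
      rw [← map_add]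
      apply key
      simp only [map_add, Function.surjInv_eq]
    map_smul' := fun c x => by
      rw [RingHom.id_apply, ← map_smul]
      apply key
      simp only [map_smul, Function.surjInv_eq] }

@[simp]
theorem descend_mk {N : Type*} [AddCommGroup N] [Module k N] (T : PathAlgebra k Q →ₗ[k] N)
    (hT : ∀ f, MonomialAlgebra.mk k Z f = 0 → T f = 0) (f : PathAlgebra k Q) :
    descend T hT (MonomialAlgebra.mk k Z f) = T f := by
  rw [← sub_eq_zero]
  change T _ - T f = 0
  rw [← map_sub]
  exact hT _ (by rw [map_sub, Function.surjInv_eq (mk_surjective k Z), sub_self])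

/-- The coefficient of a nonzero path in an element of `Λ`. -/
def coeff {u v : Q} {p : Path u v} (hp : IsNonzeroPath Z p) : MonomialAlgebra k Z →ₗ[k] k :=
  descend
    { toFun := fun f : PathAlgebra k Q => f u v p
      map_add' := fun _ _ => rfl
      map_smul' := fun _ _ => rfl }
    fun _ hf => apply_eq_zero_of_mk_eq_zero hf hp

theorem coeff_mk {u v : Q} {p : Path u v} (hp : IsNonzeroPath Z p) (f : PathAlgebra k Q) :
    coeff hp (MonomialAlgebra.mk k Z f) = f u v p :=
  descend_mk _ _ f

theorem coeff_pathClass [∀ u v : Q, DecidableEq (Path u v)] {u v : Q} {p : Path u v}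
    (hp : IsNonzeroPath Z p) (q : Path u v) :
    coeff hp (pathClass k Z q) = if q = p then 1 else 0 := by
  rw [pathClass, coeff_mk, ofPath_eq_embed, embed_apply_self, Finsupp.single_apply]

end Quotient

/-! ### Derivations of degree zero as families of matrices -/

section PathDerivation

variable {k : Type uk} [Field k] {Q : Type uq} [Quiver.{ua} Q] [∀ u v : Q, Fintype (u ⟶ v)]
  (m : ∀ u v : Q, Matrix (u ⟶ v) (u ⟶ v) k)

/-- The sum over all positions of a path of the paths in which the arrow `a` at that position is
replaced by an arrow `b`, with coefficient `m b a`. -/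
def replaceSum {u : Q} : ∀ {v : Q}, Path u v → (Path u v →₀ k)
  | _, .nil => 0
  | w, .cons (b := v) p a =>
    concat k u v w (replaceSum p) (Finsupp.single a.toPath 1) +
      ∑ b, Finsupp.single (p.cons b) (m v w b a)

theorem replaceSum_comp {u v w : Q} (p : Path u v) (q : Path v w) :
    replaceSum m (p.comp q) = concat k u v w (replaceSum m p) (Finsupp.single q 1) +
      concat k u v w (Finsupp.single p 1) (replaceSum m q) := by
  induction q with
  | nil => simp [replaceSum, concat_nil_right]
  | cons q a ih =>
    rw [Path.comp_cons, replaceSum, ih, replaceSum, map_add, LinearMap.add_apply, map_add,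
      concat_assoc, concat_assoc, concat_single, map_sum, add_assoc]
    simp [concat_single]

theorem replaceSum_toPath {u v : Q} (a : u ⟶ v) :
    replaceSum m a.toPath = ∑ b, Finsupp.single b.toPath (m u v b a) := by
  simp [replaceSum, Hom.toPath]

theorem replaceSum_mem {u v : Q} (p : Path u v) (W : Submodule k (Path u v →₀ k))
    (h : ∀ (x y : Q) (l : Path u x) (a b : x ⟶ y) (r : Path y v), (l.cons a).comp r = p →
      m x y b a ≠ 0 → Finsupp.single ((l.cons b).comp r) 1 ∈ W) : replaceSum m p ∈ W := by
  induction p with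
  | nil => exact W.zero_mem
  | cons p a ih =>
    refine W.add_mem ?_ (W.sum_mem fun b _ => ?_)
    · refine ih (W.comap ((concat k _ _ _).flip (Finsupp.single a.toPath 1))) ?_
      rintro x y l a' b r rfl hne
      simpa using h x y l a' b (r.cons a) rfl hne
    · by_cases hb : m _ _ b a = 0
      · rw [hb, Finsupp.single_zero]; exact W.zero_mem
      · have := W.smul_mem (m _ _ b a) (h _ _ p a b Path.nil rfl hb)
        simpa using this

/-- Only a replacement at the chosen position can produce this path: one inside `r` leaves the
prefix `l.cons a` intact, one inside `l` leaves the last arrow `a` of that prefix, and both disagree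
with `l.cons b`. So no other terms contribute, in any characteristic. -/
theorem replaceSum_apply_replace {c d u v : Q} (l : Path c u) (r : Path v d) {a b : u ⟶ v}
    (hab : a ≠ b) : replaceSum m ((l.cons a).comp r) ((l.cons b).comp r) = m u v b a := by
  have hne : l.cons a ≠ l.cons b := fun h => hab (eq_of_heq (Path.hom_heq_of_cons_eq_cons h))
  rw [replaceSum_comp, Finsupp.add_apply, concat_single_right_apply, replaceSum,
    Finsupp.add_apply]
  have h1 : concat k c v d (Finsupp.single (l.cons a) 1) (replaceSum m r) ((l.cons b).comp r)
      = 0 := by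
    by_contra h
    obtain ⟨p, q, hp, hq, hpq⟩ := exists_comp_of_concat_apply_ne_zero _ _ h
    -- A term of a product with a single path on the left must begin with that path.
    have hp' : l.cons a = p := by
      classical
      by_contra hne
      simp [hne] at hp
    subst hp'
    exact hne ((Path.comp_inj' (by simp)).1 hpq).1
  have h2 : concat k c u v (replaceSum m l) (Finsupp.single a.toPath 1) (l.cons b) = 0 := by
    by_contra h
    obtain ⟨p, q, hp, hq, hpq⟩ := exists_comp_of_concat_apply_ne_zero _ _ h
    have hq' : a.toPath = q := by
      classical
      by_contra hne
      simp [hne] at hq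
    subst hq'
    exact hab (eq_of_heq (Path.hom_heq_of_cons_eq_cons hpq))
  rw [h1, h2, zero_add, add_zero, Finsupp.finsetSum_apply, Finset.sum_eq_single b]
  · simp
  · intro b' _ hb'
    refine Finsupp.single_eq_of_ne fun h => hb' ?_
    exact (eq_of_heq (Path.hom_heq_of_cons_eq_cons h)).symm
  · simp

theorem linearCombination_replaceSum_concat {u v w : Q} (f : Path u v →₀ k) (g : Path v w →₀ k) :
    Finsupp.linearCombination k (replaceSum m) (concat k u v w f g) =
      concat k u v w f (Finsupp.linearCombination k (replaceSum m) g) +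
        concat k u v w (Finsupp.linearCombination k (replaceSum m) f) g := by
  induction f using Finsupp.induction_linear with
  | zero => simp
  | add f f' hf hf' => simp only [map_add, LinearMap.add_apply, hf, hf']; abel
  | single p a =>
    induction g using Finsupp.induction_linear with
    | zero => simp
    | add g g' hg hg' => simp only [map_add, hg, hg']; abel
    | single q b =>
      have ha : Finsupp.single p a = a • Finsupp.single p (1 : k) := by simp
      have hb : Finsupp.single q b = b • Finsupp.single q (1 : k) := by simp
      rw [ha, hb]
      simp only [map_smul, LinearMap.smul_apply, concat_single, mul_one,
        Finsupp.linearCombination_single, one_smul, replaceSum_comp, smul_add]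
      rw [smul_comm b a, smul_comm b a, add_comm]

variable [Fintype Q] [DecidableEq Q]

/-- The derivation of the path algebra that vanishes on vertices and is given on arrows by the
matrices `m`. -/
def pathDerivation : PathAlgebra k Q →ₗ[k] PathAlgebra k Q where
  toFun f u v := Finsupp.linearCombination k (replaceSum m) (f u v)
  map_add' f g := by
    ext1 u v
    exact map_add (Finsupp.linearCombination k (replaceSum m)) (f u v) (g u v)
  map_smul' c f := by
    ext1 u v
    exact map_smul (Finsupp.linearCombination k (replaceSum m)) c (f u v)

theorem pathDerivation_apply (f : PathAlgebra k Q) (u v : Q) :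
    pathDerivation m f u v = Finsupp.linearCombination k (replaceSum m) (f u v) := rfl

theorem pathDerivation_ofPath {u v : Q} (p : Path u v) :
    pathDerivation m (ofPath k p) = embed k u v (replaceSum m p) := by
  ext1 x y
  rw [pathDerivation_apply, ofPath_eq_embed]
  by_cases hx : x = u
  · subst hx
    by_cases hy : y = v
    · subst hy
      rw [embed_apply_self, embed_apply_self]; simp
    · simp [embed_apply, hy]
  · simp [embed_apply, hx]

theorem pathDerivation_mul (f g : PathAlgebra k Q) :
    pathDerivation m (f * g) = f * pathDerivation m g + pathDerivation m f * g := by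
  ext1 u w
  rw [pathDerivation_apply, PathAlgebra.add_def, PathAlgebra.mul_def, PathAlgebra.mul_def,
    PathAlgebra.mul_def, map_sum, ← Finset.sum_add_distrib]
  refine Finset.sum_congr rfl fun v _ => ?_
  rw [linearCombination_replaceSum_concat, add_comm]
  rfl

variable {m} {Z : ∀ u v : Q, Set (Path u v)}

/-- By the Leibniz rule the `f` for which both `f` and its image vanish in Λ form a two-sided ideal,
so it suffices to treat the paths in Z, where saturation kills every replaced path. -/
theorem mk_pathDerivation_eq_zero
    (hm : ∀ (u v : Q) (a b : u ⟶ v), m u v b a ≠ 0 → IsSaturated Z b a) {f : PathAlgebra k Q}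
    (hf : MonomialAlgebra.mk k Z f = 0) :
    MonomialAlgebra.mk k Z (pathDerivation m f) = 0 := by
  let J : TwoSidedIdeal (PathAlgebra k Q) := TwoSidedIdeal.mk'
    {f | MonomialAlgebra.mk k Z f = 0 ∧ MonomialAlgebra.mk k Z (pathDerivation m f) = 0}
    (by simp)
    (fun {f g} hf hg => by
      simp only [Set.mem_ofPred_eq, map_add, hf.1, hg.1, hf.2, hg.2, add_zero, and_self])
    (fun {f} hf => by simp only [Set.mem_ofPred_eq, map_neg, hf.1, hf.2, neg_zero, and_self])
    (fun {f g} hg => by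
      simp only [Set.mem_ofPred_eq, pathDerivation_mul, map_add, map_mul, hg.1, hg.2, mul_zero,
        add_zero, and_self])
    (fun {f g} hf => by
      simp only [Set.mem_ofPred_eq, pathDerivation_mul, map_add, map_mul, hf.1, hf.2, zero_mul,
        add_zero, and_self])
  have hJ : relationIdeal Z k ≤ J := by
    refine TwoSidedIdeal.span_le.2 ?_
    rintro _ ⟨c, d, z, hz, rfl⟩
    refine (TwoSidedIdeal.mem_mk' _ _ _ _ _ _ _).2
      ⟨(mk_eq_zero_iff Z _).2 (TwoSidedIdeal.subset_span ⟨c, d, z, hz, rfl⟩), ?_⟩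
    rw [pathDerivation_ofPath]
    refine replaceSum_mem m z
      (LinearMap.ker ((MonomialAlgebra.mk k Z).toLinearMap ∘ₗ embed k c d)) ?_
    rintro x y l a b r rfl hne
    exact pathClass_eq_zero (hm x y a b hne c d l r hz)
  exact ((TwoSidedIdeal.mem_mk' _ _ _ _ _ _ _).1 (hJ ((mk_eq_zero_iff Z f).1 hf))).2

/-- The linear endomorphism of `Λ` induced by `pathDerivation m`. -/
def matrixEndomorphism (hm : ∀ (u v : Q) (a b : u ⟶ v), m u v b a ≠ 0 → IsSaturated Z b a) :
    Module.End k (MonomialAlgebra k Z) :=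
  descend ((MonomialAlgebra.mk k Z).toLinearMap ∘ₗ pathDerivation m)
    (by intro f hf; exact mk_pathDerivation_eq_zero hm hf)

theorem matrixEndomorphism_mk
    (hm : ∀ (u v : Q) (a b : u ⟶ v), m u v b a ≠ 0 → IsSaturated Z b a) (f : PathAlgebra k Q) :
    matrixEndomorphism hm (MonomialAlgebra.mk k Z f) =
      MonomialAlgebra.mk k Z (pathDerivation m f) :=
  descend_mk _ _ f

/-- The derivation of `Λ` given on arrows by the matrices `m`. -/
def matrixDerivation (hm : ∀ (u v : Q) (a b : u ⟶ v), m u v b a ≠ 0 → IsSaturated Z b a) :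
    derivations k (MonomialAlgebra k Z) :=
  ⟨matrixEndomorphism hm, fun a b => by
    obtain ⟨a, rfl⟩ := mk_surjective k Z a
    obtain ⟨b, rfl⟩ := mk_surjective k Z b
    rw [← map_mul, matrixEndomorphism_mk, matrixEndomorphism_mk, matrixEndomorphism_mk,
      pathDerivation_mul, map_add, map_mul, map_mul]⟩

theorem matrixDerivation_pathClass
    (hm : ∀ (u v : Q) (a b : u ⟶ v), m u v b a ≠ 0 → IsSaturated Z b a) {u v : Q} (p : Path u v) :
    (matrixDerivation hm).1 (pathClass k Z p) =
      MonomialAlgebra.mk k Z (embed k u v (replaceSum m p)) := by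
  rw [← pathDerivation_ofPath]
  exact matrixEndomorphism_mk hm _

theorem mk_embed_replaceSum_toPath {u v : Q} (a : u ⟶ v) :
    MonomialAlgebra.mk k Z (embed k u v (replaceSum m a.toPath)) =
      ∑ b : u ⟶ v, m u v b a • pathClass k Z b.toPath := by
  rw [replaceSum_toPath, map_sum, map_sum]
  refine Finset.sum_congr rfl fun b _ => ?_
  rw [pathClass, ofPath_eq_embed, ← map_smul, ← map_smul, Finsupp.smul_single_one]

/-- A derivation given by matrices on arrows is given by the replacement sums on all paths. -/
theorem derivation_pathClass {d : derivations k (MonomialAlgebra k Z)}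
    (h0 : ∀ e : Q, d.1 (pathClass k Z (Path.nil : Path e e)) = 0)
    (h1 : ∀ (u v : Q) (a : u ⟶ v),
      d.1 (pathClass k Z a.toPath) = ∑ b : u ⟶ v, m u v b a • pathClass k Z b.toPath)
    {u v : Q} (p : Path u v) :
    d.1 (pathClass k Z p) = MonomialAlgebra.mk k Z (embed k u v (replaceSum m p)) := by
  induction p with
  | nil => rw [h0, replaceSum, map_zero, map_zero]
  | cons p a ih =>
    have hd := d.2 (pathClass k Z a.toPath) (pathClass k Z p)
    rw [← pathClass_comp, ih, h1, ← mk_embed_replaceSum_toPath] at hd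
    rw [Path.comp_toPath_eq_cons] at hd
    rw [hd, ← Path.comp_toPath_eq_cons, replaceSum_comp, map_add, map_add, pathClass, pathClass,
      ofPath_eq_embed, ofPath_eq_embed, ← map_mul, ← map_mul, embed_mul_embed, embed_mul_embed]

/-- A path in Z is zero in Λ, hence so is its image. If a replacement of one `a` by `b` gave a path
in B, its coefficient in that image would be `m u v b a`, which would have to vanish. -/
theorem isSaturated_of_derivation {d : derivations k (MonomialAlgebra k Z)}
    (h0 : ∀ e : Q, d.1 (pathClass k Z (Path.nil : Path e e)) = 0)
    (h1 : ∀ (u v : Q) (a : u ⟶ v),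
      d.1 (pathClass k Z a.toPath) = ∑ b : u ⟶ v, m u v b a • pathClass k Z b.toPath)
    {u v : Q} {a b : u ⟶ v} (hab : m u v b a ≠ 0) : IsSaturated Z b a := by
  intro c e l r hz hB
  have hza : ¬ IsNonzeroPath Z ((l.cons a).comp r) := fun h =>
    h _ _ _ hz ⟨Path.nil, Path.nil, by simp⟩
  by_cases hne : a = b
  · subst hne; exact hza hB
  have := derivation_pathClass h0 h1 ((l.cons a).comp r)
  rw [pathClass_eq_zero hza, map_zero] at this
  have h2 := apply_eq_zero_of_mk_eq_zero this.symm hB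
  rw [embed_apply_self, replaceSum_apply_replace m l r hne] at h2
  exact hab h2

end PathDerivation

/-! ### The coefficient matrices of a derivation of degree zero -/

section Pairs

variable {k : Type uk} [Field k] {Q : Type uq} [Quiver.{ua} Q]

theorem IsSaturated.refl {Z : ∀ u v : Q, Set (Path u v)} {u v : Q} (a : u ⟶ v) : IsSaturated Z a a :=
  fun _ _ _ _ hz hB => hB _ _ _ hz ⟨Path.nil, Path.nil, by simp⟩

theorem pair_apply [DecidableEq Q] [∀ u v : Q, DecidableEq (u ⟶ v)] {u v : Q} (a b x y : u ⟶ v) :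
    pair k a b ⟨u, v, x, y⟩ = if a = x ∧ b = y then 1 else 0 := by
  classical
  rw [pair, Finsupp.single_apply]
  simp

theorem pair_apply_ne_zero [DecidableEq Q] {u v u' v' : Q} {a b : u ⟶ v} {x y : u' ⟶ v'}
    (h : pair k a b ⟨u', v', x, y⟩ ≠ 0) :
    (⟨u, v, a, b⟩ : ParallelArrows Q) = ⟨u', v', x, y⟩ := by
  classical
  by_contra hne
  exact h (by rw [pair, Finsupp.single_apply, if_neg hne])

end Pairs

section CoeffMatrix

variable {k : Type uk} [Field k] {Q : Type uq} [Quiver.{ua} Q] [∀ u v : Q, Fintype (u ⟶ v)]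
  [∀ u v : Q, DecidableEq (u ⟶ v)] [Fintype Q] [DecidableEq Q]
  {Z : ∀ u v : Q, Set (Path u v)} (hZ : IsMinimalRelations Z)

/-- The coefficient of the arrow `b` in an element of `Λ`. -/
def arrowCoeff {u v : Q} (b : u ⟶ v) : MonomialAlgebra k Z →ₗ[k] k :=
  coeff (hZ.isNonzeroPath_toPath b)

omit [∀ u v : Q, Fintype (u ⟶ v)] in
theorem arrowCoeff_pathClass {u v : Q} (a b : u ⟶ v) :
    arrowCoeff hZ b (pathClass k Z a.toPath) = if b = a then 1 else 0 := by
  classical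
  rw [arrowCoeff, coeff_pathClass]
  refine if_congr ⟨fun h => (toPath_injective h).symm, ?_⟩ rfl rfl
  rintro rfl; rfl

theorem arrowCoeff_sum {u v : Q} (f : (u ⟶ v) → k) (b : u ⟶ v) :
    arrowCoeff hZ b (∑ a, f a • pathClass k Z a.toPath) = f b := by
  simp [arrowCoeff_pathClass]

theorem eq_sum_of_mem_arrowSpan {u v : Q} {x : MonomialAlgebra k Z} (hx : x ∈ arrowSpan k Z u v) :
    x = ∑ b : u ⟶ v, arrowCoeff hZ b x • pathClass k Z b.toPath := by
  obtain ⟨f, rfl⟩ := (Submodule.mem_span_range_iff_exists_fun k).1 hx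
  simp only [arrowCoeff_sum]

theorem degreeZero_toPath (d : degreeZeroDerivations k Z) {u v : Q} (a : u ⟶ v) :
    d.1.1 (pathClass k Z a.toPath) = ∑ b : u ⟶ v,
      arrowCoeff hZ b (d.1.1 (pathClass k Z a.toPath)) • pathClass k Z b.toPath :=
  eq_sum_of_mem_arrowSpan hZ (d.2.2 u v a)

/-- The matrix of a derivation of degree zero on the arrows from `u` to `v`. -/
def coeffMatrix (u v : Q) : degreeZeroDerivations k Z →ₗ⁅k⁆ Matrix (u ⟶ v) (u ⟶ v) k where
  toFun d := Matrix.of fun b a => arrowCoeff hZ b (d.1.1 (pathClass k Z a.toPath))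
  map_add' d d' := by ext b a; exact map_add (arrowCoeff hZ b) _ _
  map_smul' c d := by ext b a; exact map_smul (arrowCoeff hZ b) _ _
  map_lie' {d d'} := by
    ext b a
    have key : ∀ d d' : degreeZeroDerivations k Z,
        arrowCoeff hZ b (d.1.1 (d'.1.1 (pathClass k Z a.toPath))) =
          ∑ t : u ⟶ v, arrowCoeff hZ b (d.1.1 (pathClass k Z t.toPath)) *
            arrowCoeff hZ t (d'.1.1 (pathClass k Z a.toPath)) := by
      intro d d'
      conv_lhs => rw [degreeZero_toPath hZ d' a]
      simp [mul_comm]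
    rw [Ring.lie_def, Matrix.sub_apply, Matrix.mul_apply, Matrix.mul_apply]
    simp only [Matrix.of_apply]
    -- Columns are indexed by the arrow being mapped, so composition of derivations is the matrix
    -- product in the same order.
    rw [← key, ← key, ← map_sub]
    rfl

theorem coeffMatrix_apply (d : degreeZeroDerivations k Z) {u v : Q} (a b : u ⟶ v) :
    coeffMatrix hZ u v d b a = arrowCoeff hZ b (d.1.1 (pathClass k Z a.toPath)) := rfl

theorem degreeZero_toPath_eq_sum (d : degreeZeroDerivations k Z) {u v : Q} (a : u ⟶ v) :
    d.1.1 (pathClass k Z a.toPath) =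
      ∑ b : u ⟶ v, coeffMatrix hZ u v d b a • pathClass k Z b.toPath :=
  degreeZero_toPath hZ d a

theorem isSaturated_of_coeffMatrix_ne_zero (d : degreeZeroDerivations k Z) {u v : Q}
    {a b : u ⟶ v} (h : coeffMatrix hZ u v d b a ≠ 0) : IsSaturated Z b a :=
  isSaturated_of_derivation (m := fun u v => coeffMatrix hZ u v d) (d := d.1) d.2.1
    (fun _ _ a => degreeZero_toPath_eq_sum hZ d a) h

theorem degreeZero_ext {d d' : degreeZeroDerivations k Z}
    (h : ∀ u v, coeffMatrix hZ u v d = coeffMatrix hZ u v d') : d = d' := by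
  refine Subtype.ext (Subtype.ext (monomialAlgebra_linearMap_ext fun u v p => ?_))
  rw [derivation_pathClass (m := fun u v => coeffMatrix hZ u v d) (d := d.1) d.2.1
      (fun _ _ a => degreeZero_toPath_eq_sum hZ d a),
    derivation_pathClass (m := fun u v => coeffMatrix hZ u v d') (d := d'.1) d'.2.1
      (fun _ _ a => degreeZero_toPath_eq_sum hZ d' a)]
  simp only [h]

theorem exists_coeffMatrix_eq (m : ∀ u v : Q, Matrix (u ⟶ v) (u ⟶ v) k)
    (hm : ∀ (u v : Q) (a b : u ⟶ v), m u v b a ≠ 0 → IsSaturated Z b a) :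
    ∃ d : degreeZeroDerivations k Z, ∀ u v, coeffMatrix hZ u v d = m u v := by
  have h : ∀ (u v : Q) (a : u ⟶ v), (matrixDerivation hm).1 (pathClass k Z a.toPath) =
      ∑ b : u ⟶ v, m u v b a • pathClass k Z b.toPath := fun u v a => by
    rw [matrixDerivation_pathClass, mk_embed_replaceSum_toPath]
  refine ⟨⟨matrixDerivation hm, fun e => ?_, fun u v a => ?_⟩, fun u v => ?_⟩
  · rw [matrixDerivation_pathClass, replaceSum, map_zero, map_zero]
  · rw [h]
    exact Submodule.sum_mem _ fun b _ => Submodule.smul_mem _ _ (Submodule.subset_span ⟨b, rfl⟩)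
  · ext b a
    rw [coeffMatrix_apply, h, arrowCoeff_sum]

theorem isGivenBy_iff (d : derivations k (MonomialAlgebra k Z)) (x : ParallelArrows Q →₀ k) :
    IsGivenBy Z d x ↔ ∃ h : d ∈ degreeZeroDerivations k Z,
      ∀ (u v : Q) (a b : u ⟶ v), coeffMatrix hZ u v ⟨d, h⟩ b a = x ⟨u, v, a, b⟩ := by
  constructor
  · rintro ⟨h0, h1⟩
    refine ⟨⟨h0, fun u v a => ?_⟩, fun u v a b => ?_⟩
    · rw [h1]
      exact Submodule.sum_mem _ fun b _ => Submodule.smul_mem _ _ (Submodule.subset_span ⟨b, rfl⟩)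
    · rw [coeffMatrix_apply, h1, arrowCoeff_sum hZ fun b => x ⟨u, v, a, b⟩]
  · rintro ⟨h, hx⟩
    refine ⟨h.1, fun u v a => ?_⟩
    simp only [← hx]
    exact degreeZero_toPath_eq_sum hZ ⟨d, h⟩ a

include hZ in
theorem isCocycle_iff (x : ParallelArrows Q →₀ k) :
    IsCocycle Z x ↔ ∀ (u v : Q) (a b : u ⟶ v), x ⟨u, v, a, b⟩ ≠ 0 → IsSaturated Z b a := by
  constructor
  · rintro ⟨d, hd⟩ u v a b hne
    obtain ⟨h, hx⟩ := (isGivenBy_iff hZ d x).1 hd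
    rw [← hx] at hne
    exact isSaturated_of_coeffMatrix_ne_zero hZ _ hne
  · intro h
    obtain ⟨d, hd⟩ := exists_coeffMatrix_eq hZ
      (fun u v => Matrix.of fun b a => x ⟨u, v, a, b⟩) h
    exact ⟨d.1, (isGivenBy_iff hZ d.1 x).2 ⟨d.2, fun u v a b => congrFun (congrFun (hd u v) b) a⟩⟩

include hZ in
theorem isCocycle_pair_iff {u v : Q} (a b : u ⟶ v) :
    IsCocycle Z (pair k a b) ↔ IsSaturated Z b a := by
  rw [isCocycle_iff hZ]
  constructor
  · intro h
    exact h u v a b (by simp [pair_apply])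
  · intro h u' v' x y hne
    cases pair_apply_ne_zero hne
    exact h

include hZ in
-- Degree zero derivations are closed under the bracket: the commutator of b ↦ a and c ↦ b sends c
-- to a with coefficient 1 when a ≠ c, and a nonzero coefficient forces saturation.
theorem IsSaturated.trans {u v : Q} {a b c : u ⟶ v} (hab : IsSaturated Z a b)
    (hbc : IsSaturated Z b c) : IsSaturated Z a c := by
  by_cases hac : a = c
  · subst hac; exact IsSaturated.refl a
  -- Saturation does not depend on a field, so any field may serve as coefficients; ℚ is chosen.
  obtain ⟨d, hd⟩ := (isCocycle_pair_iff (k := ℚ) hZ b a).2 hab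
  obtain ⟨d', hd'⟩ := (isCocycle_pair_iff (k := ℚ) hZ c b).2 hbc
  obtain ⟨h, hx⟩ := (isGivenBy_iff hZ _ _).1 hd
  obtain ⟨h', hx'⟩ := (isGivenBy_iff hZ _ _).1 hd'
  have h1 : coeffMatrix hZ u v ⁅(⟨d, h⟩ : degreeZeroDerivations ℚ Z), ⟨d', h'⟩⁆ a c = 1 := by
    rw [LieHom.map_lie, Ring.lie_def, Matrix.sub_apply, Matrix.mul_apply, Matrix.mul_apply]
    simp only [hx, hx', pair_apply]
    rw [Finset.sum_eq_single b, Finset.sum_eq_zero]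
    · simp
    · intro t _
      have : ¬ (c = t ∧ b = a) ∨ ¬ (b = c ∧ a = t) := by
        by_contra hcon
        push Not at hcon
        exact hac (hcon.1.2.symm.trans hcon.2.1)
      rcases this with h | h <;> simp [h]
    · intro t _ ht
      simp [ht.symm]
    · simp
  exact isSaturated_of_coeffMatrix_ne_zero hZ _ (h1 ▸ one_ne_zero)

/-- In the commutator of x with an arrow, only the length-zero part of x can contribute to
coefficients of arrows. It multiplies an arrow from u to v by the coefficient of x at v minus the
one at u, which is the same for all parallel arrows. -/
theorem coeffMatrix_of_inner (d : degreeZeroDerivations k Z)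
    (hd : d.1 ∈ innerDerivations k (MonomialAlgebra k Z)) (u v : Q) :
    ∃ c : k, coeffMatrix hZ u v d = c • 1 := by
  obtain ⟨x, hx⟩ := hd
  obtain ⟨f, rfl⟩ := mk_surjective k Z x
  refine ⟨f v v Path.nil - f u u Path.nil, ?_⟩
  ext b a
  rw [coeffMatrix_apply, hx, pathClass, ← map_mul, ← map_mul, ← map_sub, arrowCoeff, coeff_mk]
  have h1 : (f * ofPath k a.toPath) u v b.toPath = f v v Path.nil * (1 : Matrix _ _ k) b a := by
    rw [ofPath_eq_embed, mul_embed]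
    by_cases hab : a = b
    · subst hab
      have := concat_single_left_apply a.toPath (f v v) Path.nil
      rw [Path.comp_nil] at this
      simp [this]
    · rw [Matrix.one_apply_ne (Ne.symm hab), mul_zero]
      by_contra h
      obtain ⟨p, q, hp, hq, hpq⟩ := exists_comp_of_concat_apply_ne_zero _ _ h
      have hp' : a.toPath = p := by
        classical
        by_contra hne
        simp [hne] at hp
      subst hp'
      exact hab ((toPath_eq_comp_iff a b q).1 hpq).1
  have h2 : (ofPath k a.toPath * f) u v b.toPath = f u u Path.nil * (1 : Matrix _ _ k) b a := by
    rw [ofPath_eq_embed, embed_mul]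
    by_cases hab : a = b
    · subst hab
      have := concat_single_right_apply (f u u) a.toPath Path.nil
      rw [Path.nil_comp] at this
      simp [this]
    · rw [Matrix.one_apply_ne (Ne.symm hab), mul_zero]
      by_contra h
      obtain ⟨p, q, hp, hq, hpq⟩ := exists_comp_of_concat_apply_ne_zero _ _ h
      have hq' : a.toPath = q := by
        classical
        by_contra hne
        simp [hne] at hq
      subst hq'
      have hl := congrArg Path.length hpq
      simp only [Path.length_comp, Path.length_toPath] at hl
      obtain rfl := Path.eq_nil_of_length_zero p (by omega)
      rw [Path.nil_comp] at hpq
      exact hab (toPath_injective hpq)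
  have h3 : (f * ofPath k a.toPath - ofPath k a.toPath * f) u v b.toPath =
      (f * ofPath k a.toPath) u v b.toPath - (ofPath k a.toPath * f) u v b.toPath := by
    have : (f * ofPath k a.toPath - ofPath k a.toPath * f) u v + (ofPath k a.toPath * f) u v =
        (f * ofPath k a.toPath) u v := by
      rw [← PathAlgebra.add_def, sub_add_cancel]
    rw [← this, Finsupp.add_apply, add_sub_cancel_right]
  rw [h3, h1, h2, Matrix.smul_apply, smul_eq_mul, sub_mul]

end CoeffMatrix

/-! ### Matrices supported on a preorder -/

section PreorderMatrices

variable (k : Type*) [Field k] {E : Type*} [Fintype E] [DecidableEq E] (r : E → E → Prop)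

open Classical in
/-- The class of an element for the equivalence relation attached to the preorder `r`. -/
def eqvClass (a : E) : Finset E := Finset.univ.filter fun b => AntisymmRel r a b

/-- The condition on a class to contribute to the semisimple quotient. -/
def IsLargeClass (S : Finset E) : Prop := 2 ≤ S.card ∧ (CharP k 2 → 2 < S.card)

open Classical in
/-- The number of elements below `a`. -/
def height (a : E) : ℕ := (Finset.univ.filter fun t => r t a).card

variable {r}

omit [DecidableEq E] in
theorem mem_eqvClass {a b : E} : b ∈ eqvClass r a ↔ AntisymmRel r a b := by
  simp [eqvClass]

omit [DecidableEq E] in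
-- Everything below `b` is below `a` by transitivity, while `a` itself is below `a` only. Height
-- thus turns the strict part of the preorder into a strict inequality of numbers, which measures
-- nilpotency.
theorem height_lt_height (htrans : ∀ a b c, r a b → r b c → r a c) (hrefl : ∀ a, r a a)
    {a b : E} (hba : r b a) (hab : ¬ r a b) : height r b < height r a := by
  classical
  refine Finset.card_lt_card (Finset.ssubset_iff_of_subset ?_ |>.2 ⟨a, ?_, ?_⟩)
  · intro t ht
    simp only [Finset.mem_filter_univ] at ht ⊢
    exact htrans _ _ _ ht hba
  · simpa using hrefl a
  · simpa using hab

omit [DecidableEq E] in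
theorem height_le_card (a : E) : height r a ≤ Fintype.card E := Finset.card_le_univ _

omit [DecidableEq E] in
theorem eqvClass_eq (htrans : ∀ a b c, r a b → r b c → r a c) {a b : E}
    (h : AntisymmRel r a b) : eqvClass r a = eqvClass r b := by
  ext t
  rw [mem_eqvClass, mem_eqvClass]
  exact ⟨fun h' => ⟨htrans _ _ _ h.2 h'.1, htrans _ _ _ h'.2 h.1⟩,
    fun h' => ⟨htrans _ _ _ h.1 h'.1, htrans _ _ _ h'.2 h.2⟩⟩

omit [Fintype E] in
theorem charP_two_of_not_isLargeClass {S : Finset E} (hS : ¬ IsLargeClass k S) {a b : E}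
    (ha : a ∈ S) (hb : b ∈ S) (hab : a ≠ b) : CharP k 2 ∧ S = {a, b} := by
  have h2 : ({a, b} : Finset E).card = 2 := Finset.card_pair hab
  have hsub : ({a, b} : Finset E) ⊆ S := by
    intro t ht
    rcases Finset.mem_insert.1 ht with rfl | ht
    · exact ha
    · rwa [Finset.mem_singleton.1 ht]
  have h3 := Finset.card_le_card hsub
  rw [IsLargeClass, not_and] at hS
  have hS' := hS (h2 ▸ h3)
  push Not at hS'
  exact ⟨hS'.1, (Finset.eq_of_subset_of_card_le hsub (by omega)).symm⟩

variable (r)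

/-- A chain of subspaces of matrices: the matrices with scalar blocks on the large classes, and
successive approximations of the derived series of this subspace. -/
def solvableChain : ℕ → Submodule k (Matrix E E k)
  | 0 =>
    { carrier := {m | ∀ a b, AntisymmRel r a b → IsLargeClass k (eqvClass r a) →
        m a a = m b b ∧ (a ≠ b → m a b = 0)}
      add_mem' := fun {m m'} h h' a b hab hl =>
        ⟨by simp [(h a b hab hl).1, (h' a b hab hl).1],
          fun hne => by simp [(h a b hab hl).2 hne, (h' a b hab hl).2 hne]⟩
      zero_mem' := fun a b _ _ => by simp
      smul_mem' := fun c m h a b hab hl =>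
        ⟨by simp [(h a b hab hl).1], fun hne => by simp [(h a b hab hl).2 hne]⟩ }
  -- On a two-element class in characteristic 2, equal diagonal entries mean trace zero: this is the
  -- bound [gl(2), gl(2)] ⊆ sl(2).
  | 1 =>
    { carrier := {m | ∀ a b, AntisymmRel r a b → m a a = m b b ∧
        (IsLargeClass k (eqvClass r a) → a ≠ b → m a b = 0)}
      add_mem' := fun {m m'} h h' a b hab =>
        ⟨by simp [(h a b hab).1, (h' a b hab).1],
          fun hl hne => by simp [(h a b hab).2 hl hne, (h' a b hab).2 hl hne]⟩
      zero_mem' := fun a b _ => by simp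
      smul_mem' := fun c m h a b hab =>
        ⟨by simp [(h a b hab).1], fun hl hne => by simp [(h a b hab).2 hl hne]⟩ }
  -- In characteristic 2, [sl(2), sl(2)] consists of scalars, so every block is now diagonal.
  | 2 =>
    { carrier := {m | ∀ a b, AntisymmRel r a b → a ≠ b → m a b = 0}
      add_mem' := fun {m m'} h h' a b hab hne => by simp [h a b hab hne, h' a b hab hne]
      zero_mem' := fun a b _ _ => rfl
      smul_mem' := fun c m h a b hab hne => by simp [h a b hab hne] }
  -- Nonzero entries must raise the height by at least `n + 1`; at `n = 0` this already removes all
  -- diagonal blocks.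
  | n + 3 =>
    { carrier := {m | ∀ a b, height r b < height r a + n + 1 → m a b = 0}
      add_mem' := fun {m m'} h h' a b hab => by simp [h a b hab, h' a b hab]
      zero_mem' := fun a b _ => rfl
      smul_mem' := fun c m h a b hab => by simp [h a b hab] }

variable {r} {k}

omit [DecidableEq E] in
-- A nonzero term at `t` forces a ≤ t ≤ b, and a ≈ b then puts `t` in the class: this is why
-- diagonal blocks multiply among themselves.
theorem mul_apply_eqvClass (htrans : ∀ a b c, r a b → r b c → r a c) {x y : Matrix E E k}
    (hx : ∀ a b, x a b ≠ 0 → r a b) (hy : ∀ a b, y a b ≠ 0 → r a b) {a b : E}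
    (hab : AntisymmRel r a b) : (x * y) a b = ∑ t ∈ eqvClass r a, x a t * y t b := by
  rw [Matrix.mul_apply]
  symm
  refine Finset.sum_subset (Finset.subset_univ _) fun t _ ht => ?_
  by_contra h
  refine ht (mem_eqvClass.2 ⟨hx _ _ (left_ne_zero_of_mul h), ?_⟩)
  exact htrans _ _ _ (hy _ _ (right_ne_zero_of_mul h)) hab.2

omit [DecidableEq E] in
theorem mul_apply_of_isScalarBlock (htrans : ∀ a b c, r a b → r b c → r a c)
    (hrefl : ∀ a, r a a) {x y : Matrix E E k}
    (hx : ∀ a b, x a b ≠ 0 → r a b) (hy : ∀ a b, y a b ≠ 0 → r a b) {a b : E}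
    (hab : AntisymmRel r a b) (h : ∀ t, AntisymmRel r a t → a ≠ t → x a t = 0) :
    (x * y) a b = x a a * y a b := by
  rw [mul_apply_eqvClass htrans hx hy hab, Finset.sum_eq_single a]
  · intro t ht hta
    rw [h t (mem_eqvClass.1 ht) hta.symm, zero_mul]
  · intro ha
    exact absurd (mem_eqvClass.2 ⟨hrefl a, hrefl a⟩) ha

theorem lie_mem_solvableChain (htrans : ∀ a b c, r a b → r b c → r a c) (hrefl : ∀ a, r a a)
    {x y : Matrix E E k} (hx : ∀ a b, x a b ≠ 0 → r a b) (hy : ∀ a b, y a b ≠ 0 → r a b) (n : ℕ)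
    (hxn : x ∈ solvableChain k r n) (hyn : y ∈ solvableChain k r n) :
    ⁅x, y⁆ ∈ solvableChain k r (n + 1) := by
  rw [Ring.lie_def]
  match n with
  | 0 =>
    have hlarge : ∀ a b, AntisymmRel r a b → IsLargeClass k (eqvClass r a) →
        (x * y - y * x) a b = 0 := by
      intro a b hab hl
      rw [Matrix.sub_apply,
        mul_apply_of_isScalarBlock htrans hrefl hx hy hab fun t ht => (hxn a t ht hl).2,
        mul_apply_of_isScalarBlock htrans hrefl hy hx hab fun t ht => (hyn a t ht hl).2]
      by_cases h : a = b
      · subst h; ring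
      · rw [(hxn a b hab hl).2 h, (hyn a b hab hl).2 h]; ring
    intro a b hab
    refine ⟨?_, fun hl _ => hlarge a b hab hl⟩
    by_cases hl : IsLargeClass k (eqvClass r a)
    · rw [hlarge a a ⟨hrefl a, hrefl a⟩ hl, hlarge b b ⟨hrefl b, hrefl b⟩]
      rwa [← eqvClass_eq htrans hab]
    · by_cases hne : a = b
      · rw [hne]
      obtain ⟨hchar, hS⟩ := charP_two_of_not_isLargeClass k hl
        (mem_eqvClass.2 ⟨hrefl a, hrefl a⟩) (mem_eqvClass.2 hab) hne
      have h2 : (2 : k) = 0 := CharTwo.two_eq_zero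
      have hS' := eqvClass_eq htrans hab ▸ hS
      have haa : AntisymmRel r a a := ⟨hrefl a, hrefl a⟩
      have hbb : AntisymmRel r b b := ⟨hrefl b, hrefl b⟩
      rw [Matrix.sub_apply, Matrix.sub_apply, mul_apply_eqvClass htrans hx hy haa,
        mul_apply_eqvClass htrans hy hx haa, mul_apply_eqvClass htrans hx hy hbb,
        mul_apply_eqvClass htrans hy hx hbb, hS, hS', Finset.sum_pair hne, Finset.sum_pair hne,
        Finset.sum_pair hne, Finset.sum_pair hne]
      -- The two diagonal entries of a commutator of 2 × 2 matrices are opposite, hence equal in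
      -- characteristic 2.
      linear_combination (x a b * y b a - y a b * x b a) * h2
  | 1 =>
    intro a b hab hne
    by_cases hl : IsLargeClass k (eqvClass r a)
    · rw [Matrix.sub_apply,
        mul_apply_of_isScalarBlock htrans hrefl hx hy hab fun t ht => (hxn a t ht).2 hl,
        mul_apply_of_isScalarBlock htrans hrefl hy hx hab fun t ht => (hyn a t ht).2 hl,
        (hxn a b hab).2 hl hne, (hyn a b hab).2 hl hne]
      ring
    · obtain ⟨-, hS⟩ := charP_two_of_not_isLargeClass k hl
        (mem_eqvClass.2 ⟨hrefl a, hrefl a⟩) (mem_eqvClass.2 hab) hne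
      -- With constant diagonals on the two-element class, the off-diagonal entry of the commutator
      -- cancels term by term.
      rw [Matrix.sub_apply, mul_apply_eqvClass htrans hx hy hab,
        mul_apply_eqvClass htrans hy hx hab, hS, Finset.sum_pair hne, Finset.sum_pair hne,
        (hxn a b hab).1, (hyn a b hab).1]
      ring
  | 2 =>
    intro a b hab
    rw [Matrix.sub_apply]
    by_cases hr : AntisymmRel r a b
    · rw [mul_apply_of_isScalarBlock htrans hrefl hx hy hr (hxn a),
        mul_apply_of_isScalarBlock htrans hrefl hy hx hr (hyn a)]
      by_cases h : a = b
      · subst h; ring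
      · rw [hxn a b hr h, hyn a b hr h]; ring
    · have hmul : ∀ {x y : Matrix E E k}, (∀ a b, x a b ≠ 0 → r a b) →
          (∀ a b, y a b ≠ 0 → r a b) → (x * y) a b = 0 := by
        intro x y hx hy
        rw [Matrix.mul_apply]
        refine Finset.sum_eq_zero fun t _ => ?_
        by_contra h
        have hrab := htrans _ _ _ (hx _ _ (left_ne_zero_of_mul h)) (hy _ _ (right_ne_zero_of_mul h))
        -- Outside the classes a nonzero entry comes from a strict relation, so the height rises by
        -- at least 1.
        have := height_lt_height htrans hrefl hrab fun hba => hr ⟨hrab, hba⟩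
        have hab' : height r b < height r a + 1 := hab
        omega
      rw [hmul hx hy, hmul hy hx, sub_zero]
  | n + 3 =>
    have hmul : ∀ {x y : Matrix E E k}, x ∈ solvableChain k r (n + 3) →
        y ∈ solvableChain k r (n + 3) → ∀ a b, height r b < height r a + (n + 1) + 1 →
        (x * y) a b = 0 := by
      intro x y hx hy a b hab
      rw [Matrix.mul_apply]
      refine Finset.sum_eq_zero fun t _ => ?_
      by_contra h
      have h1 : ¬ (height r t < height r a + n + 1) := fun h' => left_ne_zero_of_mul h (hx a t h')
      have h2 : ¬ (height r b < height r t + n + 1) := fun h' => right_ne_zero_of_mul h (hy t b h')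
      -- The rises in height add up to at least `2 * (n + 1)`, which is at least `n + 2`.
      omega
    intro a b hab
    rw [Matrix.sub_apply, hmul hxn hyn a b hab, hmul hyn hxn a b hab, sub_zero]

omit [DecidableEq E] in
theorem solvableChain_eq_bot {n : ℕ} (hn : Fintype.card E ≤ n) :
    solvableChain k r (n + 3) = ⊥ := by
  refine (Submodule.eq_bot_iff _).2 fun m hm => ?_
  ext a b
  refine hm a b ?_
  have := height_le_card (r := r) b
  omega

end PreorderMatrices

/-! ### Solvable ideals -/

section Solvable

variable {k L : Type*} [CommRing k] [LieRing L] [LieAlgebra k L]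

/-- The terms of the derived series are trapped in the `U n` by induction; the `U n` need only be
subspaces, neither nested nor ideals. -/
theorem isSolvable_of_chain (I : LieIdeal k L) (U : ℕ → Submodule k L) (h0 : I.toSubmodule ≤ U 0)
    (hU : ∀ n, ∀ x ∈ U n, ∀ y ∈ U n, ⁅x, y⁆ ∈ U (n + 1)) {N : ℕ} (hN : U N = ⊥) :
    LieAlgebra.IsSolvable I := by
  have key : ∀ n, (LieAlgebra.derivedSeriesOfIdeal k L n I).toSubmodule ≤ U n := by
    intro n
    induction n with
    | zero => exact h0
    | succ n ih =>
      rw [LieAlgebra.derivedSeriesOfIdeal_succ, LieSubmodule.lieIdeal_oper_eq_linear_span']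
      refine Submodule.span_le.2 ?_
      rintro _ ⟨x, hx, y, hy, rfl⟩
      exact hU n x (ih hx) y (ih hy)
  refine LieAlgebra.IsSolvable.mk (R := k) (k := N) ?_
  rw [LieIdeal.derivedSeries_eq_bot_iff, ← LieSubmodule.toSubmodule_eq_bot, eq_bot_iff, ← hN]
  exact key N

variable {P : Type*} [LieRing P] [LieAlgebra k P]

/-- Along a surjection, the image of a bracket of ideals is the bracket of the images, so derived
series map to derived series. -/
theorem isSolvable_map_of_surjective {f : L →ₗ⁅k⁆ P} (hf : Function.Surjective f) (I : LieIdeal k L)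
    [LieAlgebra.IsSolvable I] : LieAlgebra.IsSolvable (I.map f) := by
  obtain ⟨n, hn⟩ := LieAlgebra.IsSolvable.solvable (R := k) (L := I)
  rw [LieIdeal.derivedSeries_eq_bot_iff] at hn
  have key : ∀ m, LieAlgebra.derivedSeriesOfIdeal k P m (I.map f) =
      (LieAlgebra.derivedSeriesOfIdeal k L m I).map f := by
    intro m
    induction m with
    | zero => rfl
    | succ m ih =>
      rw [LieAlgebra.derivedSeriesOfIdeal_succ, LieAlgebra.derivedSeriesOfIdeal_succ, ih,
        LieIdeal.map_bracket_eq f hf]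
  refine LieAlgebra.IsSolvable.mk (R := k) (k := n) ?_
  rw [LieIdeal.derivedSeries_eq_bot_iff, key, hn]
  exact LieIdeal.map_eq_bot_iff.2 bot_le

variable {D : Type*} [LieRing D] [LieAlgebra k D]

/-- Factorization of a Lie algebra morphism through a surjective one. -/
def factorLieHom {π : D →ₗ⁅k⁆ L} (hπ : Function.Surjective π) (φ : D →ₗ⁅k⁆ P)
    (hle : ∀ d, π d = 0 → φ d = 0) : L →ₗ⁅k⁆ P :=
  have key : ∀ d d', π d = π d' → φ d = φ d' := by
    intro d d' h
    rw [← sub_eq_zero, ← map_sub]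
    exact hle _ (by rw [map_sub, h, sub_self])
  { toFun := fun x => φ (Function.surjInv hπ x)
    map_add' := fun x y => by
      rw [← map_add]
      apply key
      simp only [map_add, Function.surjInv_eq hπ]
    map_smul' := fun c x => by
      rw [RingHom.id_apply, ← map_smul]
      apply key
      simp only [map_smul, Function.surjInv_eq hπ]
    map_lie' := fun {x y} => by
      rw [← LieHom.map_lie]
      apply key
      simp only [LieHom.map_lie, Function.surjInv_eq hπ] }

theorem factorLieHom_apply {π : D →ₗ⁅k⁆ L} (hπ : Function.Surjective π) (φ : D →ₗ⁅k⁆ P)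
    (hle : ∀ d, π d = 0 → φ d = 0) (d : D) : factorLieHom hπ φ hle (π d) = φ d := by
  rw [← sub_eq_zero]
  change φ _ - φ d = 0
  rw [← map_sub]
  exact hle _ (by rw [map_sub, Function.surjInv_eq hπ, sub_self])

theorem radical_eq_ker (ψ : L →ₗ⁅k⁆ P) (hψ : Function.Surjective ψ)
    (hker : LieAlgebra.IsSolvable ψ.ker)
    (hP : ∀ I : LieIdeal k P, LieAlgebra.IsSolvable I → I = ⊥) :
    LieAlgebra.radical k L = ψ.ker := by
  refine le_antisymm (sSup_le fun I hI => ?_) (le_sSup hker)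
  have : LieAlgebra.IsSolvable I := hI
  have h := hP (I.map ψ) (isSolvable_map_of_surjective hψ I)
  intro x hx
  have hx' := LieIdeal.mem_map (f := ψ) hx
  rw [h] at hx'
  exact (LieHom.mem_ker).2 ((LieSubmodule.mem_bot _).1 hx')

/-- Since `φ` kills the kernel of `π`, it induces ψ : L → P, whose kernel is the image of `φ.ker`
and so is solvable. Any solvable ideal of L has solvable image in P, hence image zero, so the
radical is exactly the kernel of ψ. -/
theorem radical_of_factorization {π : D →ₗ⁅k⁆ L} (hπ : Function.Surjective π) {φ : D →ₗ⁅k⁆ P}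
    (hφ : Function.Surjective φ) (hle : ∀ d, π d = 0 → φ d = 0)
    (hker : LieAlgebra.IsSolvable φ.ker)
    (hP : ∀ I : LieIdeal k P, LieAlgebra.IsSolvable I → I = ⊥) :
    (LieAlgebra.radical k L).toSubmodule =
      φ.ker.toSubmodule.map (π : D →ₗ[k] L) ∧
    Nonempty ((L ⧸ LieAlgebra.radical k L) ≃ₗ⁅k⁆ P) := by
  set ψ := factorLieHom hπ φ hle with hψdef
  have hψπ : ∀ d, ψ (π d) = φ d := factorLieHom_apply hπ φ hle
  have hψ : Function.Surjective ψ := by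
    intro p
    obtain ⟨d, rfl⟩ := hφ p
    exact ⟨π d, hψπ d⟩
  have hkereq : ψ.ker.toSubmodule = φ.ker.toSubmodule.map (π : D →ₗ[k] L) := by
    ext x
    constructor
    · intro hx
      obtain ⟨d, rfl⟩ := hπ x
      exact ⟨d, LieHom.mem_ker.2 ((hψπ d).symm.trans (LieHom.mem_ker.1 hx)), rfl⟩
    · rintro ⟨d, hd, rfl⟩
      exact LieHom.mem_ker.2 ((hψπ d).trans (LieHom.mem_ker.1 hd))
  -- The image of an ideal as a `LieIdeal` is the ideal it generates; here the plain linear image is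
  -- already an ideal, being the kernel of ψ.
  have hmap : φ.ker.map π = ψ.ker := by
    refine le_antisymm (LieIdeal.map_le_iff_le_comap.2 fun d hd => ?_) fun x hx => ?_
    · exact LieIdeal.mem_comap.2 (LieHom.mem_ker.2 ((hψπ d).trans (LieHom.mem_ker.1 hd)))
    · have hx' : x ∈ ψ.ker.toSubmodule := hx
      rw [hkereq] at hx'
      obtain ⟨d, hd, rfl⟩ := hx'
      exact LieIdeal.mem_map hd
  have hsol : LieAlgebra.IsSolvable ψ.ker := by
    rw [← hmap]
    exact isSolvable_map_of_surjective hπ φ.ker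
  have hrad := radical_eq_ker ψ hψ hsol hP
  refine ⟨by rw [hrad, hkereq], ?_⟩
  rw [hrad]
  exact ⟨ψ.quotKerEquivRange.trans (LieEquiv.ofEq _ ⊤ (by
    rw [(LieHom.range_eq_top ψ).2 hψ]) |>.trans LieSubalgebra.topEquiv)⟩

end Solvable

/-! ### The Lie algebras `pgl(n, k)` have no nonzero solvable ideal -/

section PglIdeals

variable {n : ℕ} {k : Type uk} [Field k]

variable (n k) in
/-- The canonical projection `gl(n, k) → pgl(n, k)`. -/
def Pgl.mk : Matrix (Fin n) (Fin n) k →ₗ⁅k⁆ Pgl n k where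
  __ := (scalarMatrices n k).toSubmodule.mkQ
  map_lie' {x y} := LieSubmodule.Quotient.mk_bracket (scalarMatrices n k) x y

theorem Pgl.mk_surjective : Function.Surjective (Pgl.mk n k) :=
  Submodule.mkQ_surjective _

theorem Pgl.mk_eq_zero_iff (x : Matrix (Fin n) (Fin n) k) :
    Pgl.mk n k x = 0 ↔ ∃ c : k, x = c • 1 := by
  refine (Submodule.Quotient.mk_eq_zero (scalarMatrices n k).toSubmodule).trans ?_
  refine Submodule.mem_span_singleton.trans ?_
  exact exists_congr fun c => eq_comm

theorem exists_third {n : ℕ} (hn : 3 ≤ n) (i j : Fin n) : ∃ l : Fin n, l ≠ i ∧ l ≠ j := by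
  have : ({i, j} : Finset (Fin n)).card < (Finset.univ : Finset (Fin n)).card := by
    rw [Finset.card_univ, Fintype.card_fin]
    exact lt_of_le_of_lt Finset.card_le_two hn
  obtain ⟨l, -, hl⟩ := Finset.exists_mem_notMem_of_card_lt_card this
  exact ⟨l, by simpa [not_or] using hl⟩

open Matrix in
theorem lie_single_single {i j l : Fin n} (h : i ≠ l) (a b : k) :
    ⁅single i j a, single j l b⁆ = single i l (a * b) := by
  rw [Ring.lie_def, single_mul_single_same, single_mul_single_of_ne _ _ _ _ h.symm, sub_zero]

open Matrix in
theorem lie_lie_single_single {i j : Fin n} (h : i ≠ j) :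
    ⁅⁅single i j (1 : k), single j i (1 : k)⁆, single i j (1 : k)⁆ = (2 : k) • single i j 1 := by
  simp only [Ring.lie_def, sub_mul, mul_sub, single_mul_single_same]
  rw [single_mul_single_of_ne _ _ _ _ h.symm, single_mul_single_of_ne _ _ _ _ h.symm, two_smul]
  simp

open Matrix in
-- Bracketing with diagonal units isolates x_ij e_ij + x_ji e_ji from an off-diagonal entry. A third
-- index, or division by 2, then separates the two terms. If x is diagonal, two different diagonal
-- entries give a nonzero multiple of e_ij as [x, e_ij].
theorem exists_single_mem_of_nonscalar (hn : 3 ≤ n ∨ (2 : k) ≠ 0)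
    (J : LieIdeal k (Matrix (Fin n) (Fin n) k)) {x : Matrix (Fin n) (Fin n) k} (hx : x ∈ J)
    (hns : ∀ c : k, x ≠ c • 1) : ∃ i j, i ≠ j ∧ single i j (1 : k) ∈ J := by
  have scale : ∀ {i j} {c : k}, c ≠ 0 → single i j c ∈ J → single i j (1 : k) ∈ J := by
    intro i j c hc h
    have := J.smul_mem c⁻¹ h
    rwa [smul_single, smul_eq_mul, inv_mul_cancel₀ hc] at this
  by_cases hoff : ∃ i j, i ≠ j ∧ x i j ≠ 0
  · obtain ⟨i, j, hij, hne⟩ := hoff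
    have hy : single i j (x i j) + single j i (x j i) ∈ J := by
      have h1 : ⁅⁅single i i (1 : k), x⁆, single j j (1 : k)⁆ ∈ J :=
        lie_mem_left k _ J _ _ (lie_mem_right k _ J _ _ hx)
      have h2 : ⁅⁅single i i (1 : k), x⁆, single j j (1 : k)⁆ =
          single i j (x i j) + single j i (x j i) := by
        simp only [Ring.lie_def, sub_mul, mul_sub]
        rw [single_mul_mul_single, mul_assoc x, single_mul_single_of_ne _ _ _ _ hij,
          ← mul_assoc (single j j (1 : k)), single_mul_single_of_ne _ _ _ _ hij.symm,
          ← mul_assoc (single j j (1 : k)), single_mul_mul_single]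
        simp
      rwa [h2] at h1
    rcases hn with hn | h2
    · obtain ⟨l, hli, hlj⟩ := exists_third hn i j
      have h1 : ⁅single l i (1 : k), single i j (x i j) + single j i (x j i)⁆ ∈ J :=
        lie_mem_right k _ J _ _ hy
      rw [lie_add, lie_single_single hlj, Ring.lie_def, single_mul_single_of_ne _ _ _ _ hij,
        single_mul_single_of_ne _ _ _ _ hli.symm, sub_zero, add_zero, one_mul] at h1
      exact ⟨l, j, hlj, scale hne h1⟩
    · have h1 : ⁅single i i (1 : k), single i j (x i j) + single j i (x j i)⁆ ∈ J :=
        lie_mem_right k _ J _ _ hy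
      rw [lie_add, lie_single_single hij, ← lie_skew, lie_single_single hij.symm, one_mul,
        mul_one] at h1
      have h3 := J.add_mem h1 hy
      have h4 : single i j (x i j) + -single j i (x j i) +
          (single i j (x i j) + single j i (x j i)) = single i j (2 * x i j) := by
        rw [two_mul, single_add]; abel
      rw [h4] at h3
      exact ⟨i, j, hij, scale (mul_ne_zero h2 hne) h3⟩
  · push Not at hoff
    have hdiag : x = diagonal fun i => x i i := by
      ext i j
      by_cases h : i = j
      · subst h; simp
      · rw [hoff i j h, diagonal_apply_ne _ h]
    obtain ⟨i, j, hij, hne⟩ : ∃ i j, i ≠ j ∧ x i i ≠ x j j := by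
      by_contra hcon
      push Not at hcon
      rcases Nat.eq_zero_or_pos n with rfl | hpos
      · exact hns 0 (by ext i; exact i.elim0)
      · refine hns (x ⟨0, hpos⟩ ⟨0, hpos⟩) ?_
        rw [hdiag, ← diagonal_one, ← diagonal_smul]
        congr 1
        ext i
        by_cases h : i = ⟨0, hpos⟩
        · subst h; simp
        · simp [hcon i _ h]
    refine ⟨i, j, hij, scale (sub_ne_zero.2 hne) ?_⟩
    have h1 : ⁅x, single i j (1 : k)⁆ ∈ J := lie_mem_left k _ J _ _ hx
    have h2 : ⁅x, single i j (1 : k)⁆ = single i j (x i i - x j j) := by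
      rw [Ring.lie_def, hdiag]
      ext p q
      simp only [Matrix.sub_apply, diagonal_mul, mul_diagonal, single_apply, diagonal_apply_eq]
      split_ifs with h
      · rw [h.1, h.2]; ring
      · ring
    rwa [h2] at h1

open Matrix in
-- Brackets with matrix units change the row or the column index, as long as the result stays off
-- the diagonal. Exchanging the two indices needs a detour through a third index, or [[e_ji, e_ij],
-- e_ji] = 2 e_ji.
theorem single_mem_of_single_mem (hn : 3 ≤ n ∨ (2 : k) ≠ 0)
    (J : LieIdeal k (Matrix (Fin n) (Fin n) k)) {i j : Fin n} (hij : i ≠ j)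
    (h : single i j (1 : k) ∈ J) {p q : Fin n} (hpq : p ≠ q) : single p q (1 : k) ∈ J := by
  have right : ∀ {i j l : Fin n}, i ≠ l → single i j (1 : k) ∈ J → single i l (1 : k) ∈ J := by
    intro i j l hil h
    have := lie_mem_left k _ J _ (single j l (1 : k)) h
    rwa [lie_single_single hil, one_mul] at this
  have left : ∀ {i j l : Fin n}, l ≠ j → single i j (1 : k) ∈ J → single l j (1 : k) ∈ J := by
    intro i j l hlj h
    have := lie_mem_right k _ J (single l i (1 : k)) _ h
    rwa [lie_single_single hlj, one_mul] at this
  have swap : single j i (1 : k) ∈ J := by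
    rcases hn with hn | h2
    · obtain ⟨l, hli, hlj⟩ := exists_third hn i j
      exact right hij.symm (left hlj.symm (right hli.symm h))
    · have h1 := lie_mem_left k _ J _ (single j i (1 : k))
        (lie_mem_right k _ J (single j i (1 : k)) _ h)
      rw [lie_lie_single_single hij.symm] at h1
      have := J.smul_mem (2 : k)⁻¹ h1
      rwa [smul_smul, inv_mul_cancel₀ h2, one_smul] at this
  by_cases hpj : p = j
  · subst hpj
    exact right hpq swap
  · exact right hpq (left hpj h)

open Matrix in
-- Each off-diagonal unit is again a bracket of such units: e_ij = [e_il, e_lj] with a third index,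
-- or 2 e_ij = [[e_ij, e_ji], e_ij] when 2 is invertible. So the derived series never loses them.
theorem Pgl.mk_single_mem_derivedSeriesOfIdeal (hn : 3 ≤ n ∨ (2 : k) ≠ 0)
    (I : LieIdeal k (Pgl n k)) (hI : ∀ i j, i ≠ j → Pgl.mk n k (single i j 1) ∈ I) (m : ℕ) :
    ∀ i j, i ≠ j → Pgl.mk n k (single i j 1) ∈ LieAlgebra.derivedSeriesOfIdeal k (Pgl n k) m I := by
  induction m with
  | zero => exact hI
  | succ m ih =>
    intro i j hij
    rw [LieAlgebra.derivedSeriesOfIdeal_succ]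
    rcases hn with hn | h2
    · obtain ⟨l, hli, hlj⟩ := exists_third hn i j
      have := LieSubmodule.lie_mem_lie (ih i l hli.symm) (ih l j hlj)
      rwa [← LieHom.map_lie, lie_single_single hij, one_mul] at this
    · have h1 := lie_mem_left k _ _ _ (Pgl.mk n k (single j i 1)) (ih i j hij)
      have h3 := LieSubmodule.lie_mem_lie h1 (ih i j hij)
      rw [← LieHom.map_lie, ← LieHom.map_lie, lie_lie_single_single hij, map_smul] at h3
      have := (⁅LieAlgebra.derivedSeriesOfIdeal k (Pgl n k) m I,
        LieAlgebra.derivedSeriesOfIdeal k (Pgl n k) m I⁆ : LieIdeal k (Pgl n k)).smul_mem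
          (2 : k)⁻¹ h3
      rwa [smul_smul, inv_mul_cancel₀ h2, one_smul] at this

theorem Pgl.eq_bot_of_isSolvable (hn : CharP k 2 → 2 < n) (I : LieIdeal k (Pgl n k))
    (hI : LieAlgebra.IsSolvable I) : I = ⊥ := by
  have hn' : 3 ≤ n ∨ (2 : k) ≠ 0 := by
    by_cases h : (2 : k) = 0
    · exact Or.inl (hn (CharTwo.of_one_ne_zero_of_two_eq_zero one_ne_zero h))
    · exact Or.inr h
  refine (LieSubmodule.eq_bot_iff I).2 fun y hy => ?_
  obtain ⟨x, rfl⟩ := Pgl.mk_surjective y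
  by_contra hne
  rw [Pgl.mk_eq_zero_iff, not_exists] at hne
  obtain ⟨i, j, hij, h⟩ := exists_single_mem_of_nonscalar hn' (I.comap (Pgl.mk n k))
    (LieIdeal.mem_comap.2 hy) hne
  obtain ⟨m, hm⟩ := hI.solvable (R := k)
  rw [LieIdeal.derivedSeries_eq_bot_iff] at hm
  have h1 := Pgl.mk_single_mem_derivedSeriesOfIdeal hn' I (fun p q hpq => LieIdeal.mem_comap.1
    (single_mem_of_single_mem hn' (I.comap (Pgl.mk n k)) hij h hpq)) m i j hij
  rw [hm, LieSubmodule.mem_bot, Pgl.mk_eq_zero_iff] at h1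
  obtain ⟨c, hc⟩ := h1
  have := congrFun (congrFun hc i) j
  simp [hij] at this

end PglIdeals

/-! ### Solvable ideals of a product of Lie algebras -/

section LieProduct

variable {k : Type*} [Field k] {ι : Type*} (L : ι → Type*) [∀ i, LieRing (L i)]
  [∀ i, LieAlgebra k (L i)]

variable (k) in
/-- The projection of a product of Lie algebras onto a factor. -/
def LieProduct.eval (i : ι) : LieProduct L →ₗ⁅k⁆ L i where
  toFun x := x i
  map_add' _ _ := rfl
  map_smul' _ _ := rfl
  map_lie' := rfl

theorem LieProduct.eval_surjective (i : ι) : Function.Surjective (LieProduct.eval k L i) := by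
  classical
  exact fun x => ⟨(Pi.single i x : ∀ i, L i), Pi.single_eq_same i x⟩

/-- Each projection sends a solvable ideal to a solvable ideal of the factor, hence to zero. No
finiteness of the index set is involved. -/
theorem LieProduct.eq_bot_of_isSolvable
    (hL : ∀ i, ∀ I : LieIdeal k (L i), LieAlgebra.IsSolvable I → I = ⊥)
    (I : LieIdeal k (LieProduct L)) (hI : LieAlgebra.IsSolvable I) : I = ⊥ := by
  refine (LieSubmodule.eq_bot_iff I).2 fun x hx => funext fun i => ?_
  have h := hL i (I.map (LieProduct.eval k L i))
    (isSolvable_map_of_surjective (LieProduct.eval_surjective L i) I)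
  have hx' := LieIdeal.mem_map (f := LieProduct.eval k L i) hx
  rw [h] at hx'
  exact (LieSubmodule.mem_bot _).1 hx'

end LieProduct

/-! ### The morphism from the derivations of degree zero to the product of the `pgl(S)` -/

section Blocks

variable {k : Type uk} [Field k] {Q : Type uq} [Quiver.{ua} Q] [∀ u v : Q, Fintype (u ⟶ v)]
  [∀ u v : Q, DecidableEq (u ⟶ v)] [Fintype Q] [DecidableEq Q]
  {Z : ∀ u v : Q, Set (Path u v)} (hZ : IsMinimalRelations Z)

include hZ in
theorem IsArrowClass.eq_eqvClass {u v : Q} {S : Finset (u ⟶ v)} (hS : IsArrowClass Z S)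
    {a : u ⟶ v} (ha : a ∈ S) : S = eqvClass (IsSaturated Z) a := by
  obtain ⟨c, hc⟩ := hS
  have hca : AntisymmRel (IsSaturated Z) c a := (hc a).1 ha
  rw [← eqvClass_eq (r := IsSaturated Z) (fun _ _ _ => IsSaturated.trans hZ) hca]
  ext b
  rw [mem_eqvClass]
  exact hc b

omit [∀ u v : Q, DecidableEq (u ⟶ v)] [Fintype Q] [DecidableEq Q] in
theorem isArrowClass_eqvClass {u v : Q} (a : u ⟶ v) :
    IsArrowClass Z (eqvClass (IsSaturated Z) a) :=
  ⟨a, fun _ => mem_eqvClass⟩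

omit [∀ u v : Q, DecidableEq (u ⟶ v)] [Fintype Q] [DecidableEq Q] in
theorem mem_eqvClass_self {u v : Q} (a : u ⟶ v) : a ∈ eqvClass (IsSaturated Z) a :=
  mem_eqvClass.2 ⟨IsSaturated.refl a, IsSaturated.refl a⟩

/-- The enumeration of the arrows in a finite set. -/
def enum {u v : Q} (S : Finset (u ⟶ v)) (i : Fin S.card) : u ⟶ v := (S.equivFin.symm i).1

omit [∀ u v : Q, Fintype (u ⟶ v)] [∀ u v : Q, DecidableEq (u ⟶ v)] [Fintype Q] [DecidableEq Q] in
theorem enum_mem {u v : Q} (S : Finset (u ⟶ v)) (i : Fin S.card) : enum S i ∈ S :=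
  (S.equivFin.symm i).2

omit [∀ u v : Q, Fintype (u ⟶ v)] [∀ u v : Q, DecidableEq (u ⟶ v)] [Fintype Q] [DecidableEq Q] in
theorem enum_injective {u v : Q} (S : Finset (u ⟶ v)) : Function.Injective (enum S) :=
  Subtype.val_injective.comp S.equivFin.symm.injective

omit [∀ u v : Q, Fintype (u ⟶ v)] [∀ u v : Q, DecidableEq (u ⟶ v)] [Fintype Q] [DecidableEq Q] in
theorem exists_enum_eq {u v : Q} {S : Finset (u ⟶ v)} {a : u ⟶ v} (ha : a ∈ S) :
    ∃ i, enum S i = a :=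
  ⟨S.equivFin ⟨a, ha⟩, by rw [enum, Equiv.symm_apply_apply]⟩

include hZ in
theorem submatrix_enum_mul {u v : Q} {S : Finset (u ⟶ v)} (hS : IsArrowClass Z S)
    {x y : Matrix (u ⟶ v) (u ⟶ v) k} (hx : ∀ a b, x a b ≠ 0 → IsSaturated Z a b)
    (hy : ∀ a b, y a b ≠ 0 → IsSaturated Z a b) :
    (x * y).submatrix (enum S) (enum S) =
      x.submatrix (enum S) (enum S) * y.submatrix (enum S) (enum S) := by
  ext i j
  have hclass := hS.eq_eqvClass hZ (enum_mem S i)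
  have hij : AntisymmRel (IsSaturated Z) (enum S i) (enum S j) := by
    rw [← mem_eqvClass, ← hclass]
    exact enum_mem S j
  rw [Matrix.submatrix_apply, mul_apply_eqvClass (r := IsSaturated Z) (fun _ _ _ => IsSaturated.trans hZ) hx hy hij,
    ← hclass, Matrix.mul_apply, ← Finset.sum_coe_sort]
  exact (Equiv.sum_comp S.equivFin.symm
    fun t : S => x (enum S i) t.1 * y t.1 (enum S j)).symm

/-- The diagonal block of a derivation of degree zero on a class of arrows. -/
def blockMap {u v : Q} {S : Finset (u ⟶ v)} (hS : IsArrowClass Z S) :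
    degreeZeroDerivations k Z →ₗ⁅k⁆ Matrix (Fin S.card) (Fin S.card) k where
  toFun d := (coeffMatrix hZ u v d).submatrix (enum S) (enum S)
  map_add' d d' := by rw [map_add]; rfl
  map_smul' c d := by rw [map_smul]; rfl
  map_lie' {d d'} := by
    rw [LieHom.map_lie, Ring.lie_def, Ring.lie_def,
      ← submatrix_enum_mul hZ hS (fun _ _ => isSaturated_of_coeffMatrix_ne_zero hZ d)
        (fun _ _ => isSaturated_of_coeffMatrix_ne_zero hZ d'),
      ← submatrix_enum_mul hZ hS (fun _ _ => isSaturated_of_coeffMatrix_ne_zero hZ d')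
        (fun _ _ => isSaturated_of_coeffMatrix_ne_zero hZ d)]
    rfl

/-- The family of the classes of the diagonal blocks of a derivation of degree zero. -/
def blocks : degreeZeroDerivations k Z →ₗ⁅k⁆ LieProduct fun S : PglFactor k Z => Pgl S.1.2.2.card k where
  toFun d S := Pgl.mk _ k (blockMap hZ S.2.1 d)
  map_add' d d' := funext fun S => by rw [map_add, map_add]; rfl
  map_smul' c d := funext fun S => by rw [map_smul, map_smul]; rfl
  map_lie' {d d'} := funext fun S => by rw [LieHom.map_lie, LieHom.map_lie]; rfl

theorem blocks_apply (d : degreeZeroDerivations k Z) (S : PglFactor k Z) :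
    blocks hZ d S = Pgl.mk _ k (blockMap hZ S.2.1 d) := rfl

theorem blocks_eq_zero_iff (d : degreeZeroDerivations k Z) :
    blocks hZ d = 0 ↔ ∀ u v, coeffMatrix hZ u v d ∈ solvableChain k (IsSaturated Z) 0 := by
  constructor
  · intro h u v a b hab hl
    obtain ⟨c, hc⟩ := (Pgl.mk_eq_zero_iff _).1
      (congrFun h ⟨⟨u, v, eqvClass (IsSaturated Z) a⟩, isArrowClass_eqvClass a, hl.1, hl.2⟩)
    obtain ⟨i, hi⟩ := exists_enum_eq (mem_eqvClass_self (Z := Z) a)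
    obtain ⟨j, hj⟩ := exists_enum_eq (mem_eqvClass.2 hab)
    have hentry : ∀ i j, coeffMatrix hZ u v d (enum (eqvClass (IsSaturated Z) a) i)
        (enum (eqvClass (IsSaturated Z) a) j) = (c • (1 : Matrix _ _ k)) i j :=
      fun i j => congrFun (congrFun hc i) j
    have h1 := hentry i i
    have h2 := hentry j j
    have h3 := hentry i j
    rw [hi] at h1 h3
    rw [hj] at h2 h3
    refine ⟨by rw [h1, h2]; simp, fun hne => ?_⟩
    have hij : i ≠ j := by
      rintro rfl
      exact hne (hi.symm.trans hj)
    rw [h3]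
    simp [hij]
  · intro h
    refine funext fun S => (Pgl.mk_eq_zero_iff _).2 ?_
    obtain ⟨⟨u, v, S⟩, hS, hl⟩ := S
    have h0 : 0 < S.card := lt_of_lt_of_le two_pos hl.1
    -- The diagonal is constant on a large class, so its entry at the first arrow is the scalar.
    refine ⟨coeffMatrix hZ u v d (enum S ⟨0, h0⟩) (enum S ⟨0, h0⟩), ?_⟩
    ext i j
    have hclass : ∀ i j, AntisymmRel (IsSaturated Z) (enum S i) (enum S j) := by
      intro i j
      refine mem_eqvClass.1 ?_
      rw [← hS.eq_eqvClass hZ (enum_mem S i)]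
      exact enum_mem S j
    have hlarge : ∀ i, IsLargeClass k (eqvClass (IsSaturated Z) (enum S i)) := by
      intro i
      rw [← hS.eq_eqvClass hZ (enum_mem S i)]
      exact hl
    change coeffMatrix hZ u v d (enum S i) (enum S j) = _
    by_cases hij : i = j
    · subst hij
      rw [(h u v _ _ (hclass i ⟨0, h0⟩) (hlarge i)).1]
      simp
    · rw [(h u v _ _ (hclass i j) (hlarge i)).2 fun h => hij (enum_injective S h)]
      simp [hij]

theorem isSolvable_ker_blocks : LieAlgebra.IsSolvable (blocks (k := k) hZ).ker := by
  refine isSolvable_of_chain (blocks (k := k) hZ).ker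
    (fun n => ⨅ u, ⨅ v, (solvableChain k (IsSaturated Z) n).comap
      (coeffMatrix (k := k) hZ u v : _ →ₗ[k] Matrix (u ⟶ v) (u ⟶ v) k)) ?_ ?_
    -- The total number of arrows bounds the heights in all parallel classes at once; the 3 is where
    -- the strictly triangular part of the chain starts.
    (N := (∑ u : Q, ∑ v : Q, Fintype.card (u ⟶ v)) + 3) ?_
  · intro d hd
    simp only [Submodule.mem_iInf]
    exact (blocks_eq_zero_iff hZ d).1 (LieHom.mem_ker.1 hd)
  · intro n x hx y hy
    simp only [Submodule.mem_iInf] at hx hy ⊢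
    intro u v
    have := lie_mem_solvableChain (r := IsSaturated Z) (fun _ _ _ => IsSaturated.trans hZ) IsSaturated.refl
      (fun _ _ => isSaturated_of_coeffMatrix_ne_zero hZ x)
      (fun _ _ => isSaturated_of_coeffMatrix_ne_zero hZ y) n (hx u v) (hy u v)
    rw [← LieHom.map_lie] at this
    exact this
  · refine (Submodule.eq_bot_iff _).2 fun d hd => degreeZero_ext hZ fun u v => ?_
    simp only [Submodule.mem_iInf] at hd
    have h1 := hd u v
    rw [solvableChain_eq_bot] at h1
    · rw [map_zero]
      exact h1
    · exact (Finset.single_le_sum (f := fun v => Fintype.card (u ⟶ v)) (fun _ _ => Nat.zero_le _)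
        (Finset.mem_univ v)).trans (Finset.single_le_sum
          (f := fun u => ∑ v : Q, Fintype.card (u ⟶ v)) (fun _ _ => Nat.zero_le _)
          (Finset.mem_univ u))

open Classical in
/-- The family of matrices with given diagonal blocks on the large classes of arrows. -/
def ofBlocks (P : ∀ S : PglFactor k Z, Matrix (Fin S.1.2.2.card) (Fin S.1.2.2.card) k) (u v : Q) :
    Matrix (u ⟶ v) (u ⟶ v) k := fun b a =>
  if h : b ∈ eqvClass (IsSaturated Z) a ∧ IsLargeClass k (eqvClass (IsSaturated Z) a) then
    P ⟨⟨u, v, eqvClass (IsSaturated Z) a⟩, isArrowClass_eqvClass a, h.2.1, h.2.2⟩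
      ((eqvClass (IsSaturated Z) a).equivFin ⟨b, h.1⟩)
      ((eqvClass (IsSaturated Z) a).equivFin ⟨a, mem_eqvClass_self a⟩)
  else 0

include hZ in
theorem ofBlocks_apply (P : ∀ S : PglFactor k Z, Matrix (Fin S.1.2.2.card) (Fin S.1.2.2.card) k)
    {u v : Q} {S : Finset (u ⟶ v)} (hS : IsArrowClass Z S) (hl : IsLargeClass k S) {a b : u ⟶ v}
    (ha : a ∈ S) (hb : b ∈ S) :
    ofBlocks P u v b a = P ⟨⟨u, v, S⟩, hS, hl.1, hl.2⟩ (S.equivFin ⟨b, hb⟩) (S.equivFin ⟨a, ha⟩) := by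
  obtain rfl := hS.eq_eqvClass hZ ha
  exact dif_pos ⟨hb, hl⟩

theorem blocks_surjective : Function.Surjective (blocks (k := k) hZ) := by
  intro p
  choose P hP using fun S => Pgl.mk_surjective (p S)
  obtain ⟨d, hd⟩ := exists_coeffMatrix_eq hZ (ofBlocks P) (by
    intro u v a b h
    by_contra hba
    refine h (dif_neg fun h' => hba ?_)
    exact (mem_eqvClass.1 h'.1).2)
  refine ⟨d, funext fun S => ?_⟩
  rw [blocks_apply, ← hP]
  congr 1
  obtain ⟨⟨u, v, S⟩, hS, hl⟩ := S
  ext i j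
  change coeffMatrix hZ u v d (enum S i) (enum S j) = _
  rw [hd, ofBlocks_apply hZ P hS hl (enum_mem S j) (enum_mem S i)]
  simp [enum]

/-! ### The projection to `L₀` -/

variable (k Z) in
/-- The class in `L₀` of a derivation of degree zero. -/
def toL0 : degreeZeroDerivations k Z →ₗ⁅k⁆ L0 k Z where
  toFun d := ⟨HH1.mk k (MonomialAlgebra k Z) d.1, ⟨d.1, d.2, rfl⟩⟩
  map_add' d d' := Subtype.ext (map_add (HH1.mk k (MonomialAlgebra k Z)) d.1 d'.1)
  map_smul' c d := Subtype.ext (map_smul (HH1.mk k (MonomialAlgebra k Z)) c d.1)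
  map_lie' {d d'} := Subtype.ext (LieHom.map_lie (HH1.mk k (MonomialAlgebra k Z)) d.1 d'.1)

omit [∀ u v : Q, Fintype (u ⟶ v)] [∀ u v : Q, DecidableEq (u ⟶ v)] in
theorem toL0_surjective : Function.Surjective (toL0 k Z) := by
  rintro ⟨_, d, hd, rfl⟩
  exact ⟨⟨d, hd⟩, rfl⟩

theorem blocks_eq_zero_of_toL0_eq_zero (d : degreeZeroDerivations k Z) (hd : toL0 k Z d = 0) :
    blocks hZ d = 0 := by
  have h : d.1 ∈ innerDerivations k (MonomialAlgebra k Z) :=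
    (Submodule.Quotient.mk_eq_zero (innerDerivations k (MonomialAlgebra k Z)).toSubmodule).1
      (congrArg Subtype.val hd)
  refine (blocks_eq_zero_iff hZ d).2 fun u v a b _ _ => ?_
  obtain ⟨c, hc⟩ := coeffMatrix_of_inner hZ d h u v
  rw [hc]
  exact ⟨by simp, fun hne => by simp [hne]⟩

end Blocks

/-! ### The radical is spanned by the generators -/

section Generators

variable {k : Type uk} [Field k] {Q : Type uq} [Quiver.{ua} Q] [∀ u v : Q, Fintype (u ⟶ v)]
  [∀ u v : Q, DecidableEq (u ⟶ v)] [Fintype Q] [DecidableEq Q]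
  {Z : ∀ u v : Q, Set (Path u v)} (hZ : IsMinimalRelations Z)

/-- A derivation of degree zero as a combination of pairs of parallel arrows. -/
def toPairs : degreeZeroDerivations k Z →ₗ[k] ParallelArrows Q →₀ k :=
  (Finsupp.linearEquivFunOnFinite k k (ParallelArrows Q)).symm.toLinearMap ∘ₗ
    { toFun := fun d p => coeffMatrix hZ p.1 p.2.1 d p.2.2.2 p.2.2.1
      map_add' := fun d d' => funext fun p => by rw [map_add]; rfl
      map_smul' := fun c d => funext fun p => by rw [map_smul]; rfl }

theorem toPairs_apply (d : degreeZeroDerivations k Z) {u v : Q} (a b : u ⟶ v) :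
    toPairs hZ d ⟨u, v, a, b⟩ = coeffMatrix hZ u v d b a := rfl

theorem toPairs_injective : Function.Injective (toPairs (k := k) hZ) := by
  intro d d' h
  refine degreeZero_ext hZ fun u v => ?_
  ext b a
  rw [← toPairs_apply, h, toPairs_apply]

theorem isGivenBy_iff_toPairs (d : derivations k (MonomialAlgebra k Z)) (x : ParallelArrows Q →₀ k) :
    IsGivenBy Z d x ↔ ∃ h : d ∈ degreeZeroDerivations k Z, toPairs hZ ⟨d, h⟩ = x := by
  rw [isGivenBy_iff hZ]
  refine exists_congr fun h => ⟨fun hx => ?_, fun hx u v a b => by rw [← hx, toPairs_apply]⟩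
  ext ⟨u, v, a, b⟩
  exact hx u v a b

theorem toPairs_eq_sum (d : degreeZeroDerivations k Z) : toPairs hZ d =
    ∑ u : Q, ∑ v : Q, ∑ a : u ⟶ v, ∑ b : u ⟶ v, coeffMatrix hZ u v d b a • pair k a b := by
  have h := (Finsupp.univ_sum_single (toPairs hZ d)).symm
  rw [Fintype.sum_sigma] at h
  rw [h]
  refine Finset.sum_congr rfl fun u _ => ?_
  rw [Fintype.sum_sigma]
  refine Finset.sum_congr rfl fun v _ => ?_
  rw [Fintype.sum_prod_type]
  refine Finset.sum_congr rfl fun a _ => Finset.sum_congr rfl fun b _ => ?_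
  rw [toPairs_apply, pair, Finsupp.smul_single_one]

include hZ in
theorem exists_pair_of_mem_charTwoElements {x : ParallelArrows Q →₀ k}
    (hx : x ∈ charTwoElements k Z) : ∃ (u v : Q) (S : Finset (u ⟶ v)), IsArrowClass Z S ∧
      ¬ IsLargeClass k S ∧ ∃ a ∈ S, ∃ b ∈ S, AntisymmRel (IsSaturated Z) a b ∧ x = pair k a b := by
  obtain ⟨h2, u, v, S, hS, hcard, a, ha, b, hb, -, h⟩ := hx
  have hab : AntisymmRel (IsSaturated Z) a b := mem_eqvClass.1 (hS.eq_eqvClass hZ ha ▸ hb)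
  refine ⟨u, v, S, hS, fun hl => absurd (hl.2 h2) (by omega), ?_⟩
  rcases h with rfl | rfl | rfl
  · exact ⟨a, ha, b, hb, hab, rfl⟩
  · exact ⟨b, hb, a, ha, hab.symm, rfl⟩
  · exact ⟨a, ha, a, ha, ⟨IsSaturated.refl a, IsSaturated.refl a⟩, rfl⟩

omit [∀ u v : Q, Fintype (u ⟶ v)] [∀ u v : Q, DecidableEq (u ⟶ v)] [Fintype Q] in
theorem sum_pair_apply_of_ne {u v : Q} (S : Finset (u ⟶ v)) {u' v' : Q} {a b : u' ⟶ v'}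
    (hab : a ≠ b) : (∑ s ∈ S, pair k s s) ⟨u', v', a, b⟩ = 0 := by
  rw [Finsupp.finsetSum_apply]
  refine Finset.sum_eq_zero fun s _ => ?_
  by_contra h
  cases pair_apply_ne_zero h
  exact hab rfl

include hZ in
theorem isCocycle_of_mem_radicalGenerators {x : ParallelArrows Q →₀ k}
    (hx : x ∈ radicalGenerators k Z) : IsCocycle Z x := by
  rcases hx with (⟨u, v, S, -, rfl⟩ | ⟨u, v, a, b, -, h, -, rfl⟩) | hx
  · refine (isCocycle_iff hZ _).2 fun u' v' a b h => ?_
    by_cases hab : a = b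
    · subst hab; exact IsSaturated.refl a
    · exact absurd (sum_pair_apply_of_ne S hab) h
  · exact h
  · obtain ⟨u, v, S, -, -, a, -, b, -, hab, rfl⟩ := exists_pair_of_mem_charTwoElements hZ hx
    exact (isCocycle_pair_iff hZ a b).2 hab.2

include hZ in
theorem sum_pair_apply_diag_eq {u v : Q} {S : Finset (u ⟶ v)} (hS : IsArrowClass Z S) {u' v' : Q}
    {a b : u' ⟶ v'} (hab : AntisymmRel (IsSaturated Z) a b) :
    (∑ s ∈ S, pair k s s) ⟨u', v', a, a⟩ = (∑ s ∈ S, pair k s s) ⟨u', v', b, b⟩ := by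
  rw [Finsupp.finsetSum_apply, Finsupp.finsetSum_apply]
  by_cases h : u = u' ∧ v = v'
  · obtain ⟨rfl, rfl⟩ := h
    have hmem : a ∈ S ↔ b ∈ S := by
      obtain ⟨c, hc⟩ := hS
      rw [hc, hc]
      exact ⟨fun h => ⟨h.1.trans hZ hab.1, hab.2.trans hZ h.2⟩,
        fun h => ⟨h.1.trans hZ hab.2, hab.1.trans hZ h.2⟩⟩
    simp only [pair_apply, and_self, Finset.sum_ite_eq', hmem]
  · have hzero : ∀ c : u' ⟶ v', ∑ s ∈ S, pair k s s ⟨u', v', c, c⟩ = 0 := by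
      intro c
      refine Finset.sum_eq_zero fun s _ => ?_
      by_contra hne
      cases pair_apply_ne_zero hne
      exact h ⟨rfl, rfl⟩
    rw [hzero, hzero]

/-- Class sums have scalar blocks, strict pairs have no entry inside any class, and the
characteristic 2 elements live in a class that is not large. -/
theorem blocks_eq_zero_of_mem_radicalGenerators {d : degreeZeroDerivations k Z}
    (hd : toPairs hZ d ∈ radicalGenerators k Z) : blocks hZ d = 0 := by
  refine (blocks_eq_zero_iff hZ d).2 fun u' v' a b hab hl => ?_
  rw [← toPairs_apply, ← toPairs_apply, ← toPairs_apply]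
  rcases hd with (⟨u, v, S, hS, h⟩ | ⟨u, v, p, q, hpq, h1, h2, h⟩) | hx
  · rw [h]
    exact ⟨sum_pair_apply_diag_eq hZ hS hab, fun hne => sum_pair_apply_of_ne S hne.symm⟩
  · rw [h]
    rw [isCocycle_pair_iff hZ] at h2
    have hdiag : ∀ c : u' ⟶ v', pair k p q ⟨u', v', c, c⟩ = 0 := by
      intro c
      by_contra hne
      cases pair_apply_ne_zero hne
      exact hpq rfl
    refine ⟨by rw [hdiag, hdiag], fun _ => ?_⟩
    by_contra hne
    cases pair_apply_ne_zero hne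
    exact h2 hab.2
  · obtain ⟨u, v, S, hS, hnl, p, hp, q, -, -, h⟩ := exists_pair_of_mem_charTwoElements hZ hx
    have key : ∀ c ∈ eqvClass (IsSaturated Z) a, ∀ c', pair k p q ⟨u', v', c, c'⟩ = 0 := by
      intro c hc c'
      by_contra hne
      cases pair_apply_ne_zero hne
      rw [← (isArrowClass_eqvClass a).eq_eqvClass hZ (mem_eqvClass_self a),
        (isArrowClass_eqvClass a).eq_eqvClass hZ hc, ← hS.eq_eqvClass hZ hp] at hl
      exact hnl hl
    have ha := mem_eqvClass_self (Z := Z) a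
    have hb := mem_eqvClass.2 hab
    rw [h, key a ha, key b hb, key b hb]
    exact ⟨rfl, fun _ => rfl⟩

include hZ in
-- A nonzero entry gives b ≤ a. If a ≤ b fails, the pair is strict; otherwise both arrows lie in one
-- class, which cannot be large and so has exactly two arrows in characteristic 2.
theorem sum_offDiag_mem_span {u v : Q} {M : Matrix (u ⟶ v) (u ⟶ v) k}
    (hM : M ∈ solvableChain k (IsSaturated Z) 0) (hsupp : ∀ b a, M b a ≠ 0 → IsSaturated Z b a)
    {a b : u ⟶ v} (hba : b ≠ a) :
    M b a • pair k a b ∈ Submodule.span k (radicalGenerators k Z) := by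
  by_cases h0 : M b a = 0
  · rw [h0, zero_smul]; exact Submodule.zero_mem _
  refine Submodule.smul_mem _ _ (Submodule.subset_span ?_)
  have hr := hsupp b a h0
  by_cases hr' : IsSaturated Z a b
  · by_cases hl : IsLargeClass k (eqvClass (IsSaturated Z) b)
    · exact absurd ((hM b a ⟨hr, hr'⟩ hl).2 hba) h0
    · have hb := mem_eqvClass_self (Z := Z) b
      have ha : a ∈ eqvClass (IsSaturated Z) b := mem_eqvClass.2 ⟨hr, hr'⟩
      obtain ⟨hchar, hS⟩ := charP_two_of_not_isLargeClass k hl hb ha hba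
      exact Or.inr ⟨hchar, u, v, _, isArrowClass_eqvClass b, by rw [hS, Finset.card_pair hba],
        a, ha, b, hb, hba.symm, Or.inl rfl⟩
  · exact Or.inl (Or.inr ⟨u, v, a, b, hba.symm, (isCocycle_pair_iff hZ a b).2 hr,
      fun h => hr' ((isCocycle_pair_iff hZ b a).1 h), rfl⟩)

/-- A constant diagonal on the class gives a multiple of the class sum. A nonconstant one excludes a
large class, so the class has two arrows in characteristic 2 and each (a, a) is itself a generator.
-/
theorem sum_diag_mem_span {u v : Q} {M : Matrix (u ⟶ v) (u ⟶ v) k}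
    (hM : M ∈ solvableChain k (IsSaturated Z) 0) (c : u ⟶ v) :
    ∑ a ∈ eqvClass (IsSaturated Z) c, M a a • pair k a a ∈
      Submodule.span k (radicalGenerators k Z) := by
  by_cases h : ∀ a ∈ eqvClass (IsSaturated Z) c, M a a = M c c
  · rw [Finset.sum_congr rfl fun a ha => by rw [h a ha], ← Finset.smul_sum]
    exact Submodule.smul_mem _ _ (Submodule.subset_span
      (Or.inl (Or.inl ⟨u, v, _, isArrowClass_eqvClass c, rfl⟩)))
  · push Not at h
    obtain ⟨b, hb, hne⟩ := h
    have hbc : c ≠ b := fun h => hne (by rw [h])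
    have hl : ¬ IsLargeClass k (eqvClass (IsSaturated Z) c) := fun hl =>
      hne ((hM c b (mem_eqvClass.1 hb) hl).1).symm
    obtain ⟨hchar, hS⟩ := charP_two_of_not_isLargeClass k hl (mem_eqvClass_self (Z := Z) c) hb hbc
    have hcard : (eqvClass (IsSaturated Z) c).card = 2 := by rw [hS, Finset.card_pair hbc]
    refine Submodule.sum_mem _ fun a ha => Submodule.smul_mem _ _ (Submodule.subset_span ?_)
    obtain ⟨a', ha', hne'⟩ := Finset.exists_mem_ne (hcard ▸ one_lt_two) a
    exact Or.inr ⟨hchar, u, v, _, isArrowClass_eqvClass c, hcard, a, ha, a', ha', hne'.symm,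
      Or.inr (Or.inr rfl)⟩

include hZ in
theorem sum_mem_span {u v : Q} {M : Matrix (u ⟶ v) (u ⟶ v) k}
    (hM : M ∈ solvableChain k (IsSaturated Z) 0) (hsupp : ∀ b a, M b a ≠ 0 → IsSaturated Z b a) :
    ∑ a : u ⟶ v, ∑ b : u ⟶ v, M b a • pair k a b ∈
      Submodule.span k (radicalGenerators k Z) := by
  have hsplit : ∀ a : u ⟶ v, ∑ b : u ⟶ v, M b a • pair k a b =
      M a a • pair k a a + ∑ b ∈ Finset.univ.erase a, M b a • pair k a b := fun a =>
    (Finset.add_sum_erase _ (fun b => M b a • pair k a b) (Finset.mem_univ a)).symm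
  rw [Finset.sum_congr rfl fun a _ => hsplit a, Finset.sum_add_distrib]
  refine Submodule.add_mem _ ?_ (Submodule.sum_mem _ fun a _ => Submodule.sum_mem _ fun b hb =>
    sum_offDiag_mem_span hZ hM hsupp (Finset.ne_of_mem_erase hb))
  -- The diagonal terms are grouped by equivalence class.
  rw [← Finset.sum_fiberwise_of_maps_to (g := eqvClass (IsSaturated Z))
    (t := Finset.univ.image (eqvClass (IsSaturated Z)))
    fun a _ => Finset.mem_image_of_mem _ (Finset.mem_univ a)]
  refine Submodule.sum_mem _ fun S hS => ?_
  obtain ⟨c, -, rfl⟩ := Finset.mem_image.1 hS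
  have hfilter : (Finset.univ.filter fun a : u ⟶ v =>
      eqvClass (IsSaturated Z) a = eqvClass (IsSaturated Z) c) = eqvClass (IsSaturated Z) c := by
    ext a
    rw [Finset.mem_filter_univ]
    constructor
    · intro h
      rw [← h]
      exact mem_eqvClass_self a
    · intro h
      exact ((isArrowClass_eqvClass c).eq_eqvClass hZ h).symm
  rw [hfilter]
  exact sum_diag_mem_span hM c

theorem ker_blocks_eq_span : (blocks (k := k) hZ).ker.toSubmodule =
    Submodule.span k {d | toPairs hZ d ∈ radicalGenerators k Z} := by
  refine le_antisymm (fun d hd => ?_) (Submodule.span_le.2 fun d hd =>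
    LieHom.mem_ker.2 (blocks_eq_zero_of_mem_radicalGenerators hZ hd))
  have h0 := (blocks_eq_zero_iff hZ d).1 (LieHom.mem_ker.1 hd)
  have h1 : toPairs hZ d ∈ Submodule.span k (radicalGenerators k Z) := by
    rw [toPairs_eq_sum]
    exact Submodule.sum_mem _ fun u _ => Submodule.sum_mem _ fun v _ =>
      sum_mem_span hZ (h0 u v) fun _ _ => isSaturated_of_coeffMatrix_ne_zero hZ d
  -- Every generator is a cocycle, so a span relation between pairs lifts to derivations, where
  -- injectivity of `toPairs` concludes.
  have h2 : toPairs hZ '' {d | toPairs hZ d ∈ radicalGenerators k Z} = radicalGenerators k Z := by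
    refine Set.image_preimage_eq_of_subset fun x hx => ?_
    obtain ⟨d, hd⟩ := isCocycle_of_mem_radicalGenerators hZ hx
    obtain ⟨h, hx⟩ := (isGivenBy_iff_toPairs hZ d x).1 hd
    exact ⟨⟨d, h⟩, hx⟩
  rw [← h2, ← Submodule.map_span] at h1
  obtain ⟨d', hd', h⟩ := h1
  rwa [← toPairs_injective hZ h]

theorem image_toL0_eq (X : Set (ParallelArrows Q →₀ k)) :
    toL0 k Z '' {d | toPairs hZ d ∈ X} = classesInL0 k Z X := by
  ext y
  constructor
  · rintro ⟨d, hd, rfl⟩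
    exact ⟨toPairs hZ d, hd, d.1, (isGivenBy_iff_toPairs hZ d.1 _).2 ⟨d.2, rfl⟩, rfl⟩
  · rintro ⟨x, hx, d, hd, hy⟩
    obtain ⟨h, rfl⟩ := (isGivenBy_iff_toPairs hZ d x).1 hd
    exact ⟨⟨d, h⟩, hx, Subtype.ext hy.symm⟩

end Generators

end MonomialHH

end

/-! ### The radical of L₀ and the quotient by it -/

open MonomialHH in
theorem mainTheorem2 {k : Type*} [Field k] [IsAlgClosed k]
    {Q : Type*} [Fintype Q] [DecidableEq Q] [Quiver Q] [∀ u v : Q, Fintype (u ⟶ v)]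
    (Z : ∀ u v : Q, Set (Quiver.Path u v)) (hZ : IsMinimalRelations Z)
    [Module.Finite k (MonomialAlgebra k Z)] :
    (∀ x ∈ radicalGenerators k Z, IsCocycle Z x) ∧
    (LieAlgebra.radical k (L0 k Z)).toSubmodule =
      Submodule.span k (classesInL0 k Z (radicalGenerators k Z)) ∧
    Nonempty ((L0 k Z ⧸ LieAlgebra.radical k (L0 k Z)) ≃ₗ⁅k⁆
      LieProduct fun S : PglFactor k Z => Pgl S.1.2.2.card k) := by
  classical
  obtain ⟨h1, h2⟩ := radical_of_factorization (toL0_surjective (k := k) (Z := Z)) (blocks_surjective hZ)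
    (blocks_eq_zero_of_toL0_eq_zero hZ) (isSolvable_ker_blocks hZ)
    (LieProduct.eq_bot_of_isSolvable _ fun S => Pgl.eq_bot_of_isSolvable S.2.2.2)
  refine ⟨fun x hx => isCocycle_of_mem_radicalGenerators hZ hx, ?_, h2⟩
  rw [h1, ker_blocks_eq_span, Submodule.map_span, ← image_toL0_eq hZ]
  rfl
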